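/- Let $n\ge 2$ and $d\ge 1$, and let $F\in\mathbb{Z}[X_1,\dots,X_n]$ be a nonzero decomposable form of degree $d$, i.e. $F(\mathbf X)=\prod_{i=1}^d L_i(\mathbf X)$ with linear forms $L_i(\mathbf X)\in\mathbb{C}[\mathbf X]$. Assume that $F$ is not, with $n=2$, a nonzero constant multiple of a power of a positive definite quadratic form in two variables. Write $\mathbf L_i\in\mathbb{C}^n$ for the coefficient vector of $L_i$ and $V(F)$ for the volume of $\{\mathbf x\in\mathbb{R}^n : |F(\mathbf x)|\le 1\}$. Let $I(F)$ be the set of all ordered $n$-tuples $(\mathbf L_{i_1},\dots,\mathbf L_{i_n})$ of linearly independent coefficient vectors, and let $J(F)\subseteq I(F)$ be the set of those tuples such that for every $1\le j<n$ either $\mathbf L_{i_{j+1}}$ is proportional to the complex conjugate $\overline{\mathbf L_{i_j}}$, or $\overline{\mathbf L_{i_j}}$ lies in the complex span of $\mathbf L_{i_1},\dots,\mathbf L_{i_j}$. If $J(F)\neq\emptyset$, put $$a(F)=\max\frac{\#\{i : \mathbf L_i\in\operatorname{span}(\mathbf L_{i_1},\dots,\mathbf L_{i_j})\}}{j},$$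 the maximum being over all tuples in $J(F)$ and all $j=1,\dots,n-1$; if $J(F)=\emptyset$, then $a(F)$ is undefined. **Proposition.** For every such $F$ and every such factorization of $F$, $V(F)$ is finite if and only if $a(F)$ is defined and $a(F)<d/n$. -/

import Mathlib

namespace DecomposableForm

open MvPolynomial

/-- The linear form `v₁ X₁ + ⋯ + vₙ Xₙ` with coefficient vector `v ∈ ℂⁿ`. -/
noncomputable def linearForm {n : ℕ} (v : Fin n → ℂ) : MvPolynomial (Fin n) ℂ :=
  ∑ j, C (v j) * X j

/-- `L₁, …, L_d ∈ ℂⁿ` are the coefficient vectors of the linear factors in a factorization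
`F(X) = ∏ᵢ Lᵢ(X)` over `ℂ` of the integral polynomial `F`. -/
def IsFactorization {n d : ℕ} (F : MvPolynomial (Fin n) ℤ) (L : Fin d → Fin n → ℂ) : Prop :=
  map (Int.castRingHom ℂ) F = ∏ i, linearForm (L i)

/-- The volume `V(F)` of `{x ∈ ℝⁿ : |F(x)| ≤ 1}` (Lebesgue measure, possibly infinite). -/
noncomputable def V {n : ℕ} (F : MvPolynomial (Fin n) ℤ) : ENNReal :=
  MeasureTheory.volume {x : Fin n → ℝ | |aeval x F| ≤ 1}

/-- The exceptional case: `n = 2` and, over `ℝ`, `F` is a nonzero constant times a (positive)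
power of a positive definite binary quadratic form. -/
def IsPosDefBinaryPower {n : ℕ} (F : MvPolynomial (Fin n) ℤ) : Prop :=
  n = 2 ∧ ∃ (q : MvPolynomial (Fin n) ℝ) (c : ℝ) (k : ℕ),
    q.IsHomogeneous 2 ∧ (∀ x : Fin n → ℝ, x ≠ 0 → 0 < eval x q) ∧ c ≠ 0 ∧ 1 ≤ k ∧
      map (Int.castRingHom ℝ) F = C c * q ^ k

/-- Coordinatewise complex conjugate of a vector. -/
def conjVec {n : ℕ} (v : Fin n → ℂ) : Fin n → ℂ := fun j => starRingEnd ℂ (v j)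

/-- The complex span of the first `j` members `L_{s₁}, …, L_{sⱼ}` of the tuple given by `s`. -/
def prefixSpan {n d : ℕ} (L : Fin d → Fin n → ℂ) (s : Fin n → Fin d) (j : ℕ) :
    Submodule ℂ (Fin n → ℂ) :=
  Submodule.span ℂ ((fun t : Fin n => L (s t)) '' {t | (t : ℕ) < j})

open scoped Classical in
/-- `I(F)`: the ordered `n`-tuples of linearly independent coefficient vectors, given by
their indices. -/
noncomputable def I {n d : ℕ} (L : Fin d → Fin n → ℂ) : Finset (Fin n → Fin d) :=
  {s | LinearIndependent ℂ (fun t => L (s t))}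

open scoped Classical in
/-- `J(F)`: those tuples in `I(F)` such that any two consecutive members `v, w` satisfy: `w` is
proportional to the conjugate of `v`, or the conjugate of `v` lies in the span of the members
up to and including `v`. The members are numbered from `0` here. -/
noncomputable def J {n d : ℕ} (L : Fin d → Fin n → ℂ) : Finset (Fin n → Fin d) :=
  {s ∈ I L | ∀ (j : ℕ) (hj : j + 1 < n),
    (∃ c : ℂ, L (s ⟨j + 1, hj⟩) = c • conjVec (L (s ⟨j, Nat.lt_of_succ_lt hj⟩))) ∨
      conjVec (L (s ⟨j, Nat.lt_of_succ_lt hj⟩)) ∈ prefixSpan L s (j + 1)}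

open scoped Classical in
/-- The number of indices `i` such that `Lᵢ` lies in the subspace `S`. -/
noncomputable def countIn {n d : ℕ} (L : Fin d → Fin n → ℂ)
    (S : Submodule ℂ (Fin n → ℂ)) : ℕ :=
  Finset.card {i : Fin d | L i ∈ S}

/-- The numbers `#{i : Lᵢ ∈ span (L_{s₁}, …, L_{sⱼ})} / j` for `s` in `J(F)` and
`j = 1, …, n - 1`. -/
noncomputable def ratios {n d : ℕ} (L : Fin d → Fin n → ℂ) : Finset ℚ :=
  (J L ×ˢ Finset.Ico 1 n).image fun p => (countIn L (prefixSpan L p.1 p.2) : ℚ) / (p.2 : ℚ)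

/-- `a(F)`, computed from the factorization `L`: the maximum of `ratios L`. The value `⊥` means
that `a(F)` is undefined; for `n ≥ 2` this is the case exactly when `J(F)` is empty. -/
noncomputable def a {n d : ℕ} (L : Fin d → Fin n → ℂ) : WithBot ℚ := (ratios L).max

theorem a_eq_bot_iff {n d : ℕ} (hn : 2 ≤ n) (L : Fin d → Fin n → ℂ) :
    a L = ⊥ ↔ J L = ∅ := by
  have h : Finset.Ico 1 n ≠ ∅ := by
    rw [Ne, Finset.Ico_eq_empty_iff]
    omega
  simp only [a, ratios, Finset.max_eq_bot, Finset.image_eq_empty, Finset.product_eq_empty]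
  tauto

end DecomposableForm

namespace DecomposableForm

open MvPolynomial MeasureTheory

variable {n d : ℕ}

/-! Both directions rest on how many forms lie in a subspace of given dimension. Since `F` is real,
unique factorization makes the lines spanned by the `L i` stable under conjugation with multiplicity
(`countIn_conjSubmodule`).

Finiteness (`volume_lt_top`): rescale the forms so that their product is unchanged and conjugate
forms have equal size `m i` at `x`. For each `x`, pick independent forms greedily by increasing
size, each followed by its conjugate when that is new; the resulting tuple lies in `J`
(`exists_greedy_mem_J`). A form outside the span of the first `j` picks is at least as large as the
next pick, while at most `r * j` forms lie inside that span, with `r < d / n`. Summation by parts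
turns `∏ m i ≤ 1` into a bound saying that the product of the picked sizes is small, with a power
saving as soon as some pick is far from `1`. So `1 ≤ ∏ decay η (m (s j))` (`one_le_prod_decay`).
Real or imaginary parts of the picks give real linear coordinates, in which this product is
dominated by an integrable function; summing over the finite set `J` and applying Markov's
inequality bounds the volume.

Infiniteness (`volume_eq_top`): if a proper nonzero conjugation-invariant `W` contains at least `d *
dim W / n` of the forms, shrinking the real coordinates attached to `W` and stretching the others at
constant volume keeps `|F| ≤ 1`, which gives infinitely many disjoint boxes of equal volume. If the
forms do not span, `W` is their span (`span_range_eq_top_of_volume_lt_top`). If a tuple in `J` has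
ratio at least `d / n`, its prefix span `S` is invariant or exceeds an invariant prefix by one
vector; in the second case, counting forms in `S`, its conjugate, their intersection and their sum
shows that the smaller prefix or the sum is a suitable `W` (`volume_eq_top_of_mem_J`). The only
obstruction is a zero prefix with sum the whole plane: then the forms lie half on a line and half on
its conjugate, the excluded case (`isPosDefBinaryPower_of_countIn`). -/

/-- The value at the real point `x` of the linear form with coefficient vector `v`. -/
noncomputable def pairing (v : Fin n → ℂ) (x : Fin n → ℝ) : ℂ := ∑ j, v j * (x j : ℂ)

theorem eval_linearForm (v : Fin n → ℂ) (x : Fin n → ℝ) :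
    eval (fun j => (x j : ℂ)) (linearForm v) = pairing v x := by
  simp [linearForm, pairing]

theorem pairing_smul (c : ℂ) (v : Fin n → ℂ) (x : Fin n → ℝ) :
    pairing (c • v) x = c * pairing v x := by
  simp [pairing, Finset.mul_sum, mul_assoc]

theorem pairing_conjVec (v : Fin n → ℂ) (x : Fin n → ℝ) :
    pairing (conjVec v) x = starRingEnd ℂ (pairing v x) := by
  simp [pairing, conjVec]

theorem pairing_re (v : Fin n → ℂ) (x : Fin n → ℝ) :
    (pairing v x).re = ∑ j, (v j).re * x j := by
  simp [pairing]

theorem pairing_im (v : Fin n → ℂ) (x : Fin n → ℝ) :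
    (pairing v x).im = ∑ j, (v j).im * x j := by
  simp [pairing]

theorem conjVec_conjVec (v : Fin n → ℂ) : conjVec (conjVec v) = v := by
  ext; simp [conjVec]

theorem conjVec_add (v w : Fin n → ℂ) : conjVec (v + w) = conjVec v + conjVec w := by
  ext; simp [conjVec]

theorem conjVec_smul (c : ℂ) (v : Fin n → ℂ) :
    conjVec (c • v) = starRingEnd ℂ c • conjVec v := by
  ext; simp [conjVec]

theorem conjVec_ne_zero {v : Fin n → ℂ} (hv : v ≠ 0) : conjVec v ≠ 0 := by
  intro h
  apply hv
  rw [← conjVec_conjVec v, h]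
  ext; simp [conjVec]

/-! ### Linear forms as irreducible polynomials, and unique factorization -/

theorem linearForm_smul (c : ℂ) (v : Fin n → ℂ) :
    linearForm (c • v) = C c * linearForm v := by
  simp [linearForm, Finset.mul_sum, mul_assoc]

theorem linearForm_zero : linearForm (0 : Fin n → ℂ) = 0 := by
  simp [linearForm]

theorem coeff_linearForm (v : Fin n → ℂ) (j : Fin n) :
    (linearForm v).coeff (Finsupp.single j 1) = v j := by
  classical
  simp [linearForm, coeff_sum, coeff_X, Finsupp.single_left_inj]

theorem linearForm_injective : Function.Injective (linearForm (n := n)) := by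
  intro v w h
  ext j
  rw [← coeff_linearForm v, h, coeff_linearForm]

theorem irreducible_linearForm {v : Fin n → ℂ} (hv : v ≠ 0) : Irreducible (linearForm v) := by
  obtain ⟨j, hj⟩ : ∃ j, v j ≠ 0 := by
    by_contra! h
    exact hv (funext h)
  apply irreducible_of_totalDegree_eq_one
  · apply le_antisymm
    · refine totalDegree_finsetSum_le fun i _ => ?_
      refine (totalDegree_mul _ _).trans ?_
      simp
    · rw [← not_lt, Nat.lt_one_iff, totalDegree_eq_zero_iff]
      intro h
      have := h (Finsupp.single j 1) (by rwa [mem_support_iff, coeff_linearForm]) j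
      simp at this
  · intro r hr
    have := hr (Finsupp.single j 1)
    rw [coeff_linearForm] at this
    exact isUnit_of_dvd_unit this (IsUnit.mk0 _ hj)

theorem associated_linearForm {v w : Fin n → ℂ} (h : Associated (linearForm v) (linearForm w)) :
    ∃ c : ℂ, c ≠ 0 ∧ w = c • v := by
  obtain ⟨u, hu⟩ := h
  obtain ⟨c, hc, hcu⟩ := MvPolynomial.isUnit_iff_eq_C_of_isReduced.mp u.isUnit
  refine ⟨c, hc.ne_zero, linearForm_injective ?_⟩
  rw [linearForm_smul, ← hu, hcu, mul_comm]

theorem countP_eq_of_rel {α : Type*} {r : α → α → Prop} {p : α → Prop} [DecidablePred p]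
    (hp : ∀ a b, r a b → (p a ↔ p b)) {s t : Multiset α} (h : Multiset.Rel r s t) :
    s.countP p = t.countP p := by
  induction h with
  | zero => rfl
  | cons hab _ ih => simp [Multiset.countP_cons, ih, hp _ _ hab]

-- Nonzero linear forms are irreducible, so the two multisets of factors agree up to units. Units
-- are nonzero constants, and membership in a subspace ignores them.
open scoped Classical in
theorem countIn_eq_of_prod_eq {A B : Fin d → Fin n → ℂ} (hA : ∀ i, A i ≠ 0) (hB : ∀ i, B i ≠ 0)
    (h : ∏ i, linearForm (A i) = ∏ i, linearForm (B i)) (S : Submodule ℂ (Fin n → ℂ)) :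
    countIn A S = countIn B S := by
  have key : Multiset.Rel Associated (Finset.univ.val.map fun i => linearForm (A i))
      (Finset.univ.val.map fun i => linearForm (B i)) := by
    apply UniqueFactorizationMonoid.factors_unique
    · intro x hx
      obtain ⟨i, -, rfl⟩ := Multiset.mem_map.mp hx
      exact irreducible_linearForm (hA i)
    · intro x hx
      obtain ⟨i, -, rfl⟩ := Multiset.mem_map.mp hx
      exact irreducible_linearForm (hB i)
    · change Associated (∏ i, linearForm (A i)) (∏ i, linearForm (B i))
      rw [h]
  rw [Multiset.rel_map] at key
  have key2 : Multiset.Rel (fun v w : Fin n → ℂ => Associated (linearForm v) (linearForm w))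
      (Finset.univ.val.map A) (Finset.univ.val.map B) := by
    rw [Multiset.rel_map]; exact key
  have := countP_eq_of_rel (p := fun v => v ∈ S) (fun v w hvw => by
    obtain ⟨c, hc, rfl⟩ := associated_linearForm hvw
    exact (S.smul_mem_iff hc).symm) key2
  rw [Multiset.countP_map, Multiset.countP_map] at this
  exact this

/-! ### The factorization of `F` and complex conjugation -/

section Factorization

variable {F : MvPolynomial (Fin n) ℤ} {L : Fin d → Fin n → ℂ}

theorem ne_zero_of_isFactorization (hF0 : F ≠ 0) (hL : IsFactorization F L) (i : Fin d) :
    L i ≠ 0 := by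
  intro h
  apply hF0
  apply map_injective (Int.castRingHom ℂ) Int.cast_injective
  rw [hL, map_zero]
  exact Finset.prod_eq_zero (Finset.mem_univ i) (by rw [h, linearForm_zero])

theorem aeval_eq_prod_pairing (hL : IsFactorization F L) (x : Fin n → ℝ) :
    ((aeval x F : ℝ) : ℂ) = ∏ i, pairing (L i) x := by
  have h : eval (fun j => (x j : ℂ)) (map (Int.castRingHom ℂ) F) = ∏ i, pairing (L i) x := by
    rw [hL, map_prod]
    simp only [eval_linearForm]
  rw [← h, eval_map, aeval_def]
  have := hom_eval₂ F (algebraMap ℤ ℝ) Complex.ofRealHom x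
  simp only [Complex.ofRealHom_eq_coe] at this
  rw [this]
  congr 1

theorem abs_aeval_eq_prod (hL : IsFactorization F L) (x : Fin n → ℝ) :
    |aeval x F| = ∏ i, ‖pairing (L i) x‖ := by
  rw [← norm_prod, ← aeval_eq_prod_pairing hL, Complex.norm_real, Real.norm_eq_abs]

theorem prod_linearForm_conjVec (hL : IsFactorization F L) :
    ∏ i, linearForm (conjVec (L i)) = ∏ i, linearForm (L i) := by
  have h : map (starRingEnd ℂ) (map (Int.castRingHom ℂ) F) = map (Int.castRingHom ℂ) F := by
    rw [map_map]
    exact congrArg (fun f : ℤ →+* ℂ => map f F) (RingHom.ext_int _ _)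
  rw [hL, map_prod] at h
  rw [← h]
  refine Finset.prod_congr rfl fun i _ => ?_
  simp [linearForm, conjVec]

/-- The image of `S` under complex conjugation. -/
def conjSubmodule (S : Submodule ℂ (Fin n → ℂ)) : Submodule ℂ (Fin n → ℂ) where
  carrier := {v | conjVec v ∈ S}
  add_mem' {v w} hv hw := by
    simp only [Set.mem_ofPred_eq, conjVec_add] at *
    exact S.add_mem hv hw
  zero_mem' := by
    have : conjVec (0 : Fin n → ℂ) = 0 := by ext; simp [conjVec]
    simp [this]
  smul_mem' c v hv := by
    simp only [Set.mem_ofPred_eq, conjVec_smul] at *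
    exact S.smul_mem _ hv

theorem mem_conjSubmodule {S : Submodule ℂ (Fin n → ℂ)} {v : Fin n → ℂ} :
    v ∈ conjSubmodule S ↔ conjVec v ∈ S := Iff.rfl

theorem conjSubmodule_conjSubmodule (S : Submodule ℂ (Fin n → ℂ)) :
    conjSubmodule (conjSubmodule S) = S := by
  ext v
  simp [mem_conjSubmodule, conjVec_conjVec]

theorem countIn_conjSubmodule (hF0 : F ≠ 0) (hL : IsFactorization F L)
    (S : Submodule ℂ (Fin n → ℂ)) : countIn L (conjSubmodule S) = countIn L S := by
  rw [← countIn_eq_of_prod_eq (fun i => conjVec_ne_zero (ne_zero_of_isFactorization hF0 hL i))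
    (ne_zero_of_isFactorization hF0 hL) (prod_linearForm_conjVec hL) S]
  rfl

theorem exists_eq_smul_conjVec (hF0 : F ≠ 0) (hL : IsFactorization F L) (i : Fin d) :
    ∃ i', ∃ c : ℂ, L i' = c • conjVec (L i) := by
  classical
  have h1 : 0 < countIn L (conjSubmodule (Submodule.span ℂ {conjVec (L i)})) := by
    refine Finset.card_pos.mpr ⟨i, ?_⟩
    simp [mem_conjSubmodule, Submodule.mem_span_singleton_self]
  rw [countIn_conjSubmodule hF0 hL] at h1
  obtain ⟨i', hi'⟩ := Finset.card_pos.mp h1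
  simp only [Finset.mem_filter, Finset.mem_univ, true_and] at hi'
  obtain ⟨c, hc⟩ := Submodule.mem_span_singleton.mp hi'
  exact ⟨i', c, hc.symm⟩

end Factorization

/-! ### Greedy tuples in `J` -/

theorem conjSubmodule_mono {S T : Submodule ℂ (Fin n → ℂ)} (h : S ≤ T) :
    conjSubmodule S ≤ conjSubmodule T := fun _ hv => h hv

/-- The span of the first `k` members of the sequence given by the indices `t`. -/
def initialSpan (L : Fin d → Fin n → ℂ) (t : ℕ → Fin d) (k : ℕ) : Submodule ℂ (Fin n → ℂ) :=
  Submodule.span ℂ ((fun i => L (t i)) '' Set.Iio k)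

theorem initialSpan_succ (L : Fin d → Fin n → ℂ) (t : ℕ → Fin d) (k : ℕ) :
    initialSpan L t (k + 1) = initialSpan L t k ⊔ Submodule.span ℂ {L (t k)} := by
  rw [initialSpan, initialSpan, ← Submodule.span_union]
  congr 1
  have : Set.Iio (k + 1) = Set.Iio k ∪ {k} := by
    ext i
    simp only [Set.mem_Iio, Set.mem_union, Set.mem_singleton_iff]
    omega
  rw [this, Set.image_union, Set.image_singleton]

theorem initialSpan_congr (L : Fin d → Fin n → ℂ) {t t' : ℕ → Fin d} {k : ℕ}
    (h : ∀ j < k, t j = t' j) : initialSpan L t k = initialSpan L t' k := by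
  rw [initialSpan, initialSpan]
  congr 1
  exact Set.image_congr fun j hj => by rw [h j hj]

theorem initialSpan_mono (L : Fin d → Fin n → ℂ) (t : ℕ → Fin d) :
    Monotone (initialSpan L t) := fun _ _ h =>
  Submodule.span_mono (Set.image_mono (Set.Iio_subset_Iio h))

theorem finrank_initialSpan_le (L : Fin d → Fin n → ℂ) (t : ℕ → Fin d) (k : ℕ) :
    Module.finrank ℂ (initialSpan L t k) ≤ k := by
  classical
  have h : (fun i => L (t i)) '' Set.Iio k =
      (((Finset.range k).image fun i => L (t i) : Finset (Fin n → ℂ)) : Set (Fin n → ℂ)) := by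
    ext; simp
  rw [initialSpan, h]
  exact (finrank_span_finset_le_card _).trans (Finset.card_image_le.trans (by simp))

theorem prefixSpan_eq_initialSpan (L : Fin d → Fin n → ℂ) (t : ℕ → Fin d) {k : ℕ} (hk : k ≤ n) :
    prefixSpan L (fun i : Fin n => t i) k = initialSpan L t k := by
  rw [prefixSpan, initialSpan]
  congr 1
  ext v
  constructor
  · rintro ⟨i, hi, rfl⟩
    exact ⟨i, hi, rfl⟩
  · rintro ⟨i, hi, rfl⟩
    exact ⟨⟨i, lt_of_lt_of_le hi hk⟩, hi, rfl⟩

theorem linearIndependent_of_notMem_initialSpan (L : Fin d → Fin n → ℂ) (t : ℕ → Fin d)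
    (k : ℕ) (h : ∀ j < k, L (t j) ∉ initialSpan L t j) :
    LinearIndependent ℂ (fun i : Fin k => L (t i)) := by
  induction k with
  | zero => exact linearIndependent_empty_type
  | succ k ih =>
    rw [linearIndependent_finSucc']
    refine ⟨?_, ?_⟩
    · exact ih fun j hj => h j (by omega)
    · have hr : Set.range (Fin.init fun i : Fin (k + 1) => L (t i)) =
          (fun i => L (t i)) '' Set.Iio k := by
        ext v
        constructor
        · rintro ⟨i, rfl⟩
          exact ⟨i, i.2, rfl⟩
        · rintro ⟨i, hi, rfl⟩
          exact ⟨⟨i, hi⟩, rfl⟩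
      rw [hr]
      exact h k (by omega)

/-- The first `k` members of the sequence `t` are chosen greedily with respect to `m`, a vector
that is not conjugation invariant modulo its predecessors being followed by its conjugate. -/
structure IsGreedy (L : Fin d → Fin n → ℂ) (m : Fin d → ℝ) (t : ℕ → Fin d) (k : ℕ) : Prop where
  notMem : ∀ j < k, L (t j) ∉ initialSpan L t j
  le : ∀ j < k, ∀ i, L i ∉ initialSpan L t j → m (t j) ≤ m i
  conj : ∀ j, j + 1 < k → (∃ c : ℂ, L (t (j + 1)) = c • conjVec (L (t j))) ∨
    conjVec (L (t j)) ∈ initialSpan L t (j + 1)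
  -- The state that makes the construction extendable: either the span is conjugation invariant and
  -- any minimal new form may follow, or the last pick still awaits its conjugate, whose addition
  -- restores invariance.
  last : initialSpan L t k ≤ conjSubmodule (initialSpan L t k) ∨
    ∃ j, k = j + 1 ∧ ∃ i, (∃ c : ℂ, L i = c • conjVec (L (t j))) ∧ L i ∉ initialSpan L t k ∧
      initialSpan L t k ⊔ Submodule.span ℂ {L i} ≤
        conjSubmodule (initialSpan L t k ⊔ Submodule.span ℂ {L i})

theorem IsGreedy.update {L : Fin d → Fin n → ℂ} {m : Fin d → ℝ} {t : ℕ → Fin d} {k : ℕ}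
    (h : IsGreedy L m t k) (i : Fin d) (hi : L i ∉ initialSpan L t k)
    (hm : ∀ i', L i' ∉ initialSpan L t k → m i ≤ m i')
    (hc : ∀ j, k = j + 1 → (∃ c : ℂ, L i = c • conjVec (L (t j))) ∨
      conjVec (L (t j)) ∈ initialSpan L t (j + 1))
    (hl : initialSpan L t k ⊔ Submodule.span ℂ {L i} ≤
        conjSubmodule (initialSpan L t k ⊔ Submodule.span ℂ {L i}) ∨
      ∃ i', (∃ c : ℂ, L i' = c • conjVec (L i)) ∧
        L i' ∉ initialSpan L t k ⊔ Submodule.span ℂ {L i} ∧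
        initialSpan L t k ⊔ Submodule.span ℂ {L i} ⊔ Submodule.span ℂ {L i'} ≤
        conjSubmodule (initialSpan L t k ⊔ Submodule.span ℂ {L i} ⊔ Submodule.span ℂ {L i'})) :
    IsGreedy L m (Function.update t k i) (k + 1) := by
  have hs : ∀ j ≤ k, initialSpan L (Function.update t k i) j = initialSpan L t j := fun j hj =>
    initialSpan_congr L fun a ha => Function.update_of_ne (by omega) _ _
  have hu : ∀ j < k, Function.update t k i j = t j := fun j hj =>
    Function.update_of_ne (by omega) _ _
  have hlast : initialSpan L (Function.update t k i) (k + 1) =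
      initialSpan L t k ⊔ Submodule.span ℂ {L i} := by
    rw [initialSpan_succ, hs k le_rfl, Function.update_self]
  refine ⟨fun j hj => ?_, fun j hj => ?_, fun j hj => ?_, ?_⟩
  · rw [hs j (by omega)]
    rcases Nat.lt_succ_iff_lt_or_eq.mp hj with hj | rfl
    · rw [hu j hj]; exact h.notMem j hj
    · rwa [Function.update_self]
  · rw [hs j (by omega)]
    rcases Nat.lt_succ_iff_lt_or_eq.mp hj with hj | rfl
    · rw [hu j hj]; exact h.le j hj
    · rwa [Function.update_self]
  · rw [hs (j + 1) (by omega), hu j (by omega)]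
    rcases Nat.lt_succ_iff_lt_or_eq.mp hj with hj | rfl
    · rw [hu _ hj]; exact h.conj j hj
    · rw [Function.update_self]
      exact hc j rfl
  · rw [hlast]
    refine hl.imp id ?_
    rintro ⟨i', h1, h2, h3⟩
    exact ⟨k, rfl, i', by rwa [Function.update_self], h2, h3⟩

theorem IsGreedy.exists_succ {L : Fin d → Fin n → ℂ} {m : Fin d → ℝ} {t : ℕ → Fin d} {k : ℕ}
    (hL0 : ∀ i, L i ≠ 0) (hconj : ∀ i, ∃ i', ∃ c : ℂ, L i' = c • conjVec (L i))
    (hspan : Submodule.span ℂ (Set.range L) = ⊤)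
    (hm : ∀ i i' (c : ℂ), L i' = c • conjVec (L i) → m i' = m i)
    (hk : k < n) (h : IsGreedy L m t k) : ∃ t', IsGreedy L m t' (k + 1) := by
  classical
  rcases h.last with hinv | ⟨j, rfl, i, ⟨c, hc⟩, hi, hinv⟩
  -- Invariant span: take a smallest form outside it. Its conjugate is either already in the
  -- enlarged span or becomes the pending next pick.
  · have hne : ∃ i, L i ∉ initialSpan L t k := by
      by_contra! hall
      have htop : initialSpan L t k = ⊤ := by
        rw [eq_top_iff, ← hspan, Submodule.span_le]
        rintro _ ⟨i, rfl⟩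
        exact hall i
      have := finrank_initialSpan_le L t k
      rw [htop, finrank_top, Module.finrank_fin_fun] at this
      omega
    obtain ⟨i, hi, hmin⟩ := Finset.exists_min_image
      (Finset.univ.filter fun i => L i ∉ initialSpan L t k) m (by simpa [Finset.Nonempty] using hne)
    simp only [Finset.mem_filter, Finset.mem_univ, true_and] at hi hmin
    refine ⟨_, h.update i hi hmin ?_ ?_⟩
    · rintro j rfl
      right
      apply hinv
      rw [initialSpan_succ]
      exact Submodule.mem_sup_right (Submodule.mem_span_singleton_self _)
    · by_cases hv : conjVec (L i) ∈ initialSpan L t k ⊔ Submodule.span ℂ {L i}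
      · left
        refine sup_le (hinv.trans (conjSubmodule_mono le_sup_left)) ?_
        rw [Submodule.span_singleton_le_iff_mem]
        exact hv
      · right
        obtain ⟨i', c, hc⟩ := hconj i
        have hc0 : c ≠ 0 := by
          rintro rfl
          exact hL0 i' (by simpa using hc)
        have hmem : conjVec (L i) ∈ Submodule.span ℂ {L i'} := by
          refine Submodule.mem_span_singleton.mpr ⟨c⁻¹, ?_⟩
          rw [hc, inv_smul_smul₀ hc0]
        refine ⟨i', ⟨c, hc⟩, ?_, ?_⟩
        · intro h'
          rw [hc] at h'
          exact hv ((Submodule.smul_mem_iff _ hc0).mp h')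
        · refine sup_le (sup_le ?_ ?_) ?_
          · exact hinv.trans (conjSubmodule_mono (le_sup_left.trans le_sup_left))
          · rw [Submodule.span_singleton_le_iff_mem]
            exact Submodule.mem_sup_right hmem
          · rw [Submodule.span_singleton_le_iff_mem, mem_conjSubmodule, hc, conjVec_smul,
              conjVec_conjVec]
            exact Submodule.smul_mem _ _ (Submodule.mem_sup_left
              (Submodule.mem_sup_right (Submodule.mem_span_singleton_self _)))
  -- The pending conjugate has the same size as the previous pick, which was minimal outside a
  -- smaller span; hence it is minimal outside the present one.
  · refine ⟨_, h.update i hi ?_ ?_ (Or.inl hinv)⟩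
    · intro i' hi'
      rw [hm _ _ c hc]
      exact h.le j (by omega) i' fun h' => hi' (initialSpan_mono L t (by omega) h')
    · intro j' hj'
      obtain rfl : j = j' := by omega
      exact Or.inl ⟨c, hc⟩

theorem exists_greedy_mem_J {L : Fin d → Fin n → ℂ} (hd : 1 ≤ d) (m : Fin d → ℝ)
    (hL0 : ∀ i, L i ≠ 0) (hconj : ∀ i, ∃ i', ∃ c : ℂ, L i' = c • conjVec (L i))
    (hspan : Submodule.span ℂ (Set.range L) = ⊤)
    (hm : ∀ i i' (c : ℂ), L i' = c • conjVec (L i) → m i' = m i) :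
    ∃ s ∈ J L, ∀ (j : Fin n) (i : Fin d), L i ∉ prefixSpan L s j → m (s j) ≤ m i := by
  have key : ∀ k ≤ n, ∃ t, IsGreedy L m t k := by
    intro k
    induction k with
    | zero =>
      intro _
      refine ⟨fun _ => ⟨0, hd⟩, ⟨by simp, by simp, by simp, Or.inl ?_⟩⟩
      simp [initialSpan]
    | succ k ih =>
      intro hk
      obtain ⟨t, ht⟩ := ih (by omega)
      exact ht.exists_succ hL0 hconj hspan hm (by omega)
  obtain ⟨t, ht⟩ := key n le_rfl
  refine ⟨fun i => t i, ?_, ?_⟩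
  · simp only [J, I, Finset.mem_filter, Finset.mem_univ, true_and]
    refine ⟨linearIndependent_of_notMem_initialSpan L t n ht.notMem, fun j hj => ?_⟩
    rw [prefixSpan_eq_initialSpan L t (by omega)]
    exact ht.conj j hj
  · intro j i
    rw [prefixSpan_eq_initialSpan L t j.2.le]
    exact ht.le j j.2 i

/-! ### Summation by parts and the decay function -/

section Weights

theorem sum_range_succ_mul_sub (t : ℕ → ℝ) (N : ℕ) :
    ∑ j ∈ Finset.range N, ((j : ℝ) + 1) * (t (j + 1) - t j) =
      (N + 1) * t N - ∑ j ∈ Finset.range (N + 1), t j := by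
  induction N with
  | zero => simp
  | succ N ih =>
    rw [Finset.sum_range_succ, ih, Finset.sum_range_succ _ (N + 1)]
    push_cast
    ring

-- Let `j` be the last index with `¬ P j`. The increments after `j` telescope to `t N - t j`, the
-- earlier ones only lower the left side, and `t j ≤ u`. Monotonicity of `P` is not needed.
open scoped Classical in
theorem sub_sum_ite_le {P : ℕ → Prop} {t : ℕ → ℝ} {u : ℝ} {N : ℕ}
    (ht : ∀ j < N, t j ≤ t (j + 1)) (h0 : ¬ P 0)
    (hP : ∀ j ≤ N, ¬ P j → t j ≤ u) (hN : P (N + 1)) :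
    t N - ∑ j ∈ Finset.range N, (if P (j + 1) then t (j + 1) - t j else 0) ≤ u := by
  induction N with
  | zero => simpa using hP 0 le_rfl h0
  | succ N ih =>
    by_cases h : P (N + 1)
    · have := ih (fun j hj => ht j (by omega)) (fun j hj => hP j (by omega)) h
      rw [Finset.sum_range_succ, if_pos h]
      linarith
    · have h1 := hP (N + 1) le_rfl h
      have h2 : 0 ≤ ∑ j ∈ Finset.range (N + 1), (if P (j + 1) then t (j + 1) - t j else 0) := by
        refine Finset.sum_nonneg fun j hj => ?_
        have := ht j (Finset.mem_range.mp hj)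
        split_ifs <;> linarith
      linarith

-- Sum `sub_sum_ite_le` over all forms and exchange the sums: each increment `t (j + 1) - t j` is
-- counted at most `r * (j + 1)` times, and summation by parts evaluates the result. In the
-- application `N = n - 1` and `t`, `u` are logarithms of sizes.
open scoped Classical in
theorem weighted_sum_nonpos {N : ℕ} {P : Fin d → ℕ → Prop} {t : ℕ → ℝ} {u : Fin d → ℝ} {r : ℝ}
    (ht : ∀ j < N, t j ≤ t (j + 1)) (h0 : ∀ i, ¬ P i 0) (hN : ∀ i, P i (N + 1))
    (hP : ∀ j ≤ N, ∀ i, ¬ P i j → t j ≤ u i) (hu : ∑ i, u i ≤ 0)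
    (hr : ∀ j < N, ((Finset.univ.filter fun i => P i (j + 1)).card : ℝ) ≤ r * ((j : ℝ) + 1)) :
    (d - r * (N + 1)) * t N + r * ∑ j ∈ Finset.range (N + 1), t j ≤ 0 := by
  have h1 : ∑ i : Fin d, (t N - ∑ j ∈ Finset.range N,
      (if P i (j + 1) then t (j + 1) - t j else 0)) ≤ ∑ i, u i :=
    Finset.sum_le_sum fun i _ =>
      sub_sum_ite_le ht (h0 i) (fun j hj => hP j hj i) (hN i)
  rw [Finset.sum_sub_distrib, Finset.sum_comm] at h1
  simp only [Finset.sum_const, Finset.card_univ, Fintype.card_fin, nsmul_eq_mul] at h1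
  have h2 : ∑ j ∈ Finset.range N, ∑ i : Fin d, (if P i (j + 1) then t (j + 1) - t j else 0) ≤
      ∑ j ∈ Finset.range N, r * (((j : ℝ) + 1) * (t (j + 1) - t j)) := by
    refine Finset.sum_le_sum fun j hj => ?_
    have hj := Finset.mem_range.mp hj
    rw [← Finset.sum_filter, Finset.sum_const, nsmul_eq_mul, ← mul_assoc]
    exact mul_le_mul_of_nonneg_right (hr j hj) (by linarith [ht j hj])
  rw [← Finset.mul_sum, sum_range_succ_mul_sub] at h2
  linarith

/-- With `s = ∑ t j`, the hypothesis bounds every `t j` above by a multiple of `-s`. Since the other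
terms are bounded above, each `t j` is also bounded below by a multiple of `s`, so all `|t j|` are
controlled by `-s`. -/
theorem exists_sum_le_neg_mul_sum_abs (n : ℕ) (hn : 1 ≤ n) {α r : ℝ} (hα : 0 < α) (hr : 0 < r) :
    ∃ η : ℝ, 0 < η ∧ η ≤ 1 ∧ ∀ (t : Fin n → ℝ) (T : ℝ), (∀ j, t j ≤ T) →
      α * T + r * ∑ j, t j ≤ 0 → ∑ j, t j ≤ -(η * ∑ j, |t j|) := by
  -- `ρ` is the constant in `T ≤ ρ * (-s)`; then `|t j| ≤ (1 + n * ρ) * (-s)`, and summing over `j`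
  -- yields the value of `η`.
  set ρ := r / α with hρ
  have hρ0 : 0 < ρ := by positivity
  have hn' : (1 : ℝ) ≤ n := by exact_mod_cast hn
  have hK : 1 ≤ (n : ℝ) * (1 + n * ρ) := by
    have : (0 : ℝ) ≤ n * ρ := by positivity
    nlinarith
  refine ⟨((n : ℝ) * (1 + n * ρ))⁻¹, by positivity, inv_le_one_of_one_le₀ hK, ?_⟩
  intro t T hT h
  set s := ∑ j, t j with hs
  have hTρ : T ≤ ρ * (-s) := by
    rw [hρ, div_mul_eq_mul_div, le_div_iff₀ hα]
    linarith
  have hsn : s ≤ n * T := by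
    have := Finset.sum_le_sum (s := Finset.univ) fun j _ => hT j
    simpa using this
  have hs0 : s ≤ 0 := by
    by_contra! hpos
    have : 0 < T := by
      by_contra! hT0
      nlinarith
    nlinarith [mul_pos hα this, mul_pos hr hpos]
  have hup : ∀ j, t j ≤ ρ * (-s) := fun j => (hT j).trans hTρ
  have habs : ∀ j, |t j| ≤ (1 + n * ρ) * (-s) := by
    intro j
    rw [abs_le]
    have h1 : s = t j + ∑ i ∈ Finset.univ.erase j, t i :=
      (Finset.add_sum_erase _ _ (Finset.mem_univ j)).symm
    have h2 : ∑ i ∈ Finset.univ.erase j, t i ≤ n * (ρ * (-s)) := by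
      refine (Finset.sum_le_card_nsmul _ _ _ fun i _ => hup i).trans ?_
      rw [nsmul_eq_mul]
      refine mul_le_mul_of_nonneg_right ?_ (by nlinarith)
      exact_mod_cast (Finset.card_le_univ _).trans (by simp)
    constructor
    · nlinarith
    · nlinarith [hup j, mul_nonneg hρ0.le (neg_nonneg.mpr hs0)]
  have hsum : ∑ j, |t j| ≤ n * ((1 + n * ρ) * (-s)) := by
    have := Finset.sum_le_sum (s := Finset.univ) fun j _ => habs j
    simpa using this
  have : ((n : ℝ) * (1 + n * ρ))⁻¹ * ∑ j, |t j| ≤ -s := by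
    rw [inv_mul_le_iff₀ (by linarith)]
    linarith
  linarith

/-- The function `|y|⁻¹ min(|y|, |y|⁻¹) ^ η`. -/
noncomputable def decay (η y : ℝ) : ℝ := Real.exp (-Real.log y - η * |Real.log y|)

/-- In `log |y|` the exponent has slope `-1 ± η`, which is nonpositive because `η ≤ 1`. The point
`0` is excluded, as `Real.log 0 = 0` gives `decay η 0 = 1`. -/
theorem decay_antitone {η : ℝ} (hη : 0 ≤ η) (hη1 : η ≤ 1) {a b : ℝ} (ha : a ≠ 0)
    (hab : |a| ≤ |b|) : decay η b ≤ decay η a := by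
  rw [decay, decay, Real.exp_le_exp]
  have h : Real.log a ≤ Real.log b := by
    rw [← Real.log_abs a, ← Real.log_abs b]
    exact Real.log_le_log (abs_pos.mpr ha) hab
  have h2 : |Real.log a| - |Real.log b| ≤ Real.log b - Real.log a := by
    have := abs_sub_abs_le_abs_sub (Real.log a) (Real.log b)
    rwa [abs_of_nonpos (sub_nonpos.mpr h), neg_sub] at this
  nlinarith

/-- The function is `|y| ^ (η - 1)` near `0` and `|y| ^ (-η - 1)` near infinity. -/
theorem integrable_decay {η : ℝ} (hη : 0 < η) : MeasureTheory.Integrable (decay η) := by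
  have hmeas : Measurable (decay η) := by
    unfold decay
    fun_prop
  have hIoi : MeasureTheory.IntegrableOn (decay η) (Set.Ioi 0) := by
    have : Set.Ioi (0 : ℝ) = Set.Ioc 0 1 ∪ Set.Ioi 1 := by simp
    rw [this]
    refine MeasureTheory.IntegrableOn.union ?_ ?_
    · have h := (intervalIntegral.intervalIntegrable_rpow' (a := 0) (b := 1)
        (r := η - 1) (by linarith)).1
      refine h.congr_fun (fun y hy => ?_) measurableSet_Ioc
      have hy0 : 0 < y := hy.1
      simp only [decay]
      rw [Real.rpow_def_of_pos hy0, abs_of_nonpos (Real.log_nonpos hy0.le hy.2)]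
      ring_nf
    · have h := integrableOn_Ioi_rpow_of_lt (a := -η - 1) (c := 1) (by linarith) one_pos
      refine h.congr_fun (fun y hy => ?_) measurableSet_Ioi
      have hy0 : 1 < y := hy
      simp only [decay]
      rw [Real.rpow_def_of_pos (by linarith), abs_of_nonneg (Real.log_nonneg hy0.le)]
      ring_nf
  have heven : ∀ y, decay η (-y) = decay η y := fun y => by simp [decay]
  have hIio : MeasureTheory.IntegrableOn (decay η) (Set.Iio 0) := by
    have := MeasureTheory.IntegrableOn.comp_neg_Iio (c := (0 : ℝ)) (f := decay η)
      (by rwa [neg_zero])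
    simpa only [heven] using this
  have hzero : MeasureTheory.IntegrableOn (decay η) {0} :=
    MeasureTheory.integrableOn_singleton (hx := by simp)
  have h := (hIio.union hzero).union hIoi
  rw [← MeasureTheory.integrableOn_univ]
  convert h
  ext y
  simp only [Set.mem_univ, Set.mem_union, Set.mem_Iio, Set.mem_singleton_iff, Set.mem_Ioi, true_iff]
  rcases lt_trichotomy y 0 with h | h | h <;> simp [h]

end Weights

/-! ### Real coordinates and finiteness of the volume -/

/-- Expand the determinant of real part plus `I` times imaginary part multilinearly in the rows:
some summand is nonzero, and up to a power of `I` it is a determinant of the required kind. -/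
theorem exists_re_or_im_det_ne_zero {v : Fin n → Fin n → ℂ} (hv : LinearIndependent ℂ v) :
    ∃ M : Matrix (Fin n) (Fin n) ℝ, M.det ≠ 0 ∧
      ∀ j, (M j = fun k => (v j k).re) ∨ (M j = fun k => (v j k).im) := by
  classical
  set A : Fin n → Fin n → ℂ := fun j k => ((v j k).re : ℂ) with hA
  set B : Fin n → Fin n → ℂ := fun j k => ((v j k).im : ℂ) with hB
  have hdet : Matrix.det (Matrix.of v) ≠ 0 := by
    have := Matrix.linearIndependent_rows_iff_isUnit (A := Matrix.of v) |>.mp hv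
    exact ((Matrix.isUnit_iff_isUnit_det _).mp this).ne_zero
  have hsum : v = A + Complex.I • B := by
    ext j k
    simp only [Pi.add_apply, Pi.smul_apply, smul_eq_mul, hA, hB]
    rw [mul_comm, Complex.re_add_im]
  have hexp : Matrix.det (Matrix.of v) =
      ∑ s : Finset (Fin n), Matrix.detRowAlternating (s.piecewise A (Complex.I • B)) := by
    rw [← AlternatingMap.map_add_univ, ← hsum]
    rfl
  rw [hexp] at hdet
  obtain ⟨s, -, hs⟩ := Finset.exists_ne_zero_of_sum_ne_zero hdet
  refine ⟨Matrix.of fun j k => if j ∈ s then (v j k).re else (v j k).im, ?_, ?_⟩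
  · intro h0
    apply hs
    have h1 : s.piecewise A (Complex.I • B) =
        sᶜ.piecewise (fun j => Complex.I • (s.piecewise A B) j) (s.piecewise A B) := by
      ext j k
      by_cases hj : j ∈ s <;> simp [Finset.piecewise, hj]
    rw [h1]
    have h2 := MultilinearMap.map_piecewise_smul Matrix.detRowAlternating.toMultilinearMap (fun _ => Complex.I)
      (s.piecewise A B) sᶜ
    refine h2.trans ?_
    have h3 : Matrix.detRowAlternating (s.piecewise A B) = 0 := by
      have := congrArg Complex.ofRealHom h0
      rw [RingHom.map_det, map_zero] at this
      rw [← this]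
      change Matrix.det (Matrix.of (s.piecewise A B)) = _
      congr 1
      ext j k
      by_cases hj : j ∈ s <;> simp [Finset.piecewise, hj, hA, hB]
    exact (congrArg _ h3).trans (smul_zero _)
  · intro j
    by_cases hj : j ∈ s
    · left; ext k; simp [hj]
    · right; ext k; simp [hj]

theorem integrable_prod_comp_mulVec {g : Fin n → ℝ → ℝ} (hg : ∀ j, Integrable (g j))
    {M : Matrix (Fin n) (Fin n) ℝ} (hM : M.det ≠ 0) :
    Integrable fun x : Fin n → ℝ => ∏ j, g j (M.mulVec x j) := by
  have h1 : Integrable (fun y : Fin n → ℝ => ∏ j, g j (y j)) volume :=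
    Integrable.fintype_prod hg
  have h2 : Integrable (fun y : Fin n → ℝ => ∏ j, g j (y j))
      (Measure.map (Matrix.toLin' M) volume) := by
    rw [Real.map_matrix_volume_pi_eq_smul_volume_pi hM]
    exact h1.smul_measure ENNReal.ofReal_ne_top
  have h3 := h2.comp_measurable
    (LinearMap.continuous_of_finiteDimensional (Matrix.toLin' M)).measurable
  simpa [Function.comp_def] using h3

theorem volume_pairing_eq_zero {v : Fin n → ℂ} (hv : v ≠ 0) :
    volume {x : Fin n → ℝ | pairing v x = 0} = 0 := by
  set S : Submodule ℝ (Fin n → ℝ) :=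
    { carrier := {x | pairing v x = 0}
      add_mem' := fun {x y} hx hy => by
        simp only [Set.mem_ofPred_eq, pairing] at *
        simp [mul_add, Finset.sum_add_distrib, hx, hy]
      zero_mem' := by simp [pairing]
      smul_mem' := fun c x hx => by
        simp only [Set.mem_ofPred_eq, pairing] at *
        simp only [Pi.smul_apply, smul_eq_mul, Complex.ofReal_mul, mul_left_comm _ (c : ℂ)]
        rw [← Finset.mul_sum, hx, mul_zero] } with hS
  refine Measure.addHaar_submodule volume S ?_
  intro htop
  apply hv
  ext j
  have : Pi.single j (1 : ℝ) ∈ S := htop ▸ Submodule.mem_top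
  change pairing v _ = 0 at this
  simpa [pairing, Pi.single_apply, apply_ite Complex.ofReal] using this

theorem norm_conjVec (v : Fin n → ℂ) : ‖conjVec v‖ = ‖v‖ := by
  simp [Pi.norm_def, conjVec]

theorem prefixSpan_zero (L : Fin d → Fin n → ℂ) (s : Fin n → Fin d) : prefixSpan L s 0 = ⊥ := by
  simp [prefixSpan]

theorem prefixSpan_mono (L : Fin d → Fin n → ℂ) (s : Fin n → Fin d) :
    Monotone (prefixSpan L s) := fun _ _ h =>
  Submodule.span_mono (Set.image_mono fun _ ht => lt_of_lt_of_le ht h)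

theorem linearIndependent_of_mem_J {L : Fin d → Fin n → ℂ} {s : Fin n → Fin d} (hs : s ∈ J L) :
    LinearIndependent ℂ fun t => L (s t) := by
  simp only [J, I, Finset.mem_filter, Finset.mem_univ, true_and] at hs
  exact hs.1

theorem prefixSpan_top {L : Fin d → Fin n → ℂ} {s : Fin n → Fin d} (hs : s ∈ J L) :
    prefixSpan L s n = ⊤ := by
  have h := (linearIndependent_of_mem_J hs).span_eq_top_of_card_eq_finrank' (by simp)
  rw [← h, prefixSpan]
  congr 1
  ext v
  simp

theorem span_range_eq_top {L : Fin d → Fin n → ℂ} {s : Fin n → Fin d} (hs : s ∈ J L) :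
    Submodule.span ℂ (Set.range L) = ⊤ := by
  rw [eq_top_iff, ← prefixSpan_top hs]
  refine Submodule.span_mono ?_
  rintro _ ⟨t, -, rfl⟩
  exact ⟨s t, rfl⟩

theorem notMem_prefixSpan {L : Fin d → Fin n → ℂ} {s : Fin n → Fin d} (hs : s ∈ J L)
    {j : ℕ} (i : Fin n) (hi : j ≤ i) : L (s i) ∉ prefixSpan L s j :=
  (linearIndependent_of_mem_J hs).notMem_span_image (by simpa using hi)

theorem mem_prefixSpan (L : Fin d → Fin n → ℂ) (s : Fin n → Fin d)
    {j : ℕ} (i : Fin n) (hi : (i : ℕ) < j) : L (s i) ∈ prefixSpan L s j :=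
  Submodule.subset_span ⟨i, hi, rfl⟩

/-- The factors of the norm `‖pairing (L i) x‖` that turn the `i`-th form into one of a fixed
norm without changing the product of all forms. -/
noncomputable def scale (L : Fin d → Fin n → ℂ) (i : Fin d) : ℝ :=
  (∏ i, ‖L i‖) ^ (1 / (d : ℝ)) / ‖L i‖

theorem scale_pos {L : Fin d → Fin n → ℂ} (hL0 : ∀ i, L i ≠ 0) (i : Fin d) : 0 < scale L i := by
  have : 0 < ∏ i, ‖L i‖ := Finset.prod_pos fun i _ => norm_pos_iff.mpr (hL0 i)
  exact div_pos (Real.rpow_pos_of_pos this _) (norm_pos_iff.mpr (hL0 i))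

theorem prod_scale {L : Fin d → Fin n → ℂ} (hd : 1 ≤ d) (hL0 : ∀ i, L i ≠ 0) :
    ∏ i, scale L i = 1 := by
  have : 0 < ∏ i, ‖L i‖ := Finset.prod_pos fun i _ => norm_pos_iff.mpr (hL0 i)
  simp only [scale, Finset.prod_div_distrib, Finset.prod_const, Finset.card_univ, Fintype.card_fin]
  rw [one_div, Real.rpow_inv_natCast_pow this.le (by omega), div_self this.ne']

/-- Rescaled forms all have the same coefficient norm, so those on conjugate lines have equal
absolute value at real points. This is the symmetry that `exists_greedy_mem_J` asks of `m`. -/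
theorem scale_mul_norm_pairing_eq {L : Fin d → Fin n → ℂ} (hL0 : ∀ i, L i ≠ 0) {i i' : Fin d}
    {c : ℂ} (h : L i' = c • conjVec (L i)) (x : Fin n → ℝ) :
    scale L i' * ‖pairing (L i') x‖ = scale L i * ‖pairing (L i) x‖ := by
  have hc : c ≠ 0 := by
    rintro rfl
    exact hL0 i' (by simpa using h)
  have hc' : ‖c‖ ≠ 0 := norm_ne_zero_iff.mpr hc
  have hi : ‖L i‖ ≠ 0 := norm_ne_zero_iff.mpr (hL0 i)
  rw [scale, scale, h, pairing_smul, pairing_conjVec, norm_smul, norm_conjVec, norm_mul,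
    RCLike.norm_conj]
  field_simp

/-- In logarithms, the greedy property and the counting bound feed `weighted_sum_nonpos`; `hη` then
says `0 ≤ -∑ t j - η * ∑ |t j|`, which is the logarithm of the product. -/
theorem one_le_prod_decay {L : Fin d → Fin n → ℂ} {s : Fin n → Fin d} (hs : s ∈ J L)
    (hL0 : ∀ i, L i ≠ 0) {m : Fin d → ℝ} (hm : ∀ i, 0 < m i) (hprod : ∏ i, m i ≤ 1)
    (hle : ∀ (j : Fin n) (i : Fin d), L i ∉ prefixSpan L s j → m (s j) ≤ m i) {r η : ℝ}
    (hn : 1 ≤ n)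
    (hr : ∀ j, 1 ≤ j → j < n → (countIn L (prefixSpan L s j) : ℝ) ≤ r * j)
    (hη : ∀ (t : Fin n → ℝ) (T : ℝ), (∀ j, t j ≤ T) →
      (d - r * n) * T + r * ∑ j, t j ≤ 0 → ∑ j, t j ≤ -(η * ∑ j, |t j|)) :
    1 ≤ ∏ j, decay η (m (s j)) := by
  classical
  obtain ⟨N, rfl⟩ : ∃ N, n = N + 1 := ⟨n - 1, by omega⟩
  set t : ℕ → ℝ := fun j => if h : j < N + 1 then Real.log (m (s ⟨j, h⟩)) else 0 with ht
  have htj : ∀ j (h : j < N + 1), t j = Real.log (m (s ⟨j, h⟩)) := fun j h => dif_pos h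
  have hmono : ∀ j < N, t j ≤ t (j + 1) := by
    intro j hj
    rw [htj j (by omega), htj (j + 1) (by omega)]
    refine Real.log_le_log (hm _) (hle _ _ ?_)
    exact notMem_prefixSpan hs _ (by simp)
  have hmax : ∀ k ≤ N, ∀ j ≤ k, t j ≤ t k := by
    intro k
    induction k with
    | zero =>
      intro _ j hj
      obtain rfl : j = 0 := by omega
      rfl
    | succ k ih =>
      intro hk j hj
      rcases Nat.lt_succ_iff_lt_or_eq.mp (Nat.lt_succ_of_le hj) with h | rfl
      · exact (ih (by omega) j (by omega)).trans (hmono k (by omega))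
      · rfl
  have hsum : ∑ j : Fin (N + 1), Real.log (m (s j)) = ∑ j ∈ Finset.range (N + 1), t j := by
    rw [Finset.sum_range]
    exact Finset.sum_congr rfl fun j _ => (htj j j.2).symm
  have key := weighted_sum_nonpos (P := fun i j => L i ∈ prefixSpan L s j) (t := t)
    (u := fun i => Real.log (m i)) (r := r) hmono
    (fun i => by simpa [prefixSpan_zero] using hL0 i)
    (fun i => by rw [prefixSpan_top hs]; trivial)
    (fun j hj i hi => by
      rw [htj j (by omega)]
      exact Real.log_le_log (hm _) (hle ⟨j, by omega⟩ i hi))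
    (by
      rw [← Real.log_prod fun i _ => (hm i).ne']
      exact Real.log_nonpos (Finset.prod_nonneg fun i _ => (hm i).le) hprod)
    (fun j hj => by
      have := hr (j + 1) (by omega) (by omega)
      push_cast at this
      convert this using 2
      simp only [countIn])
  have h2 := hη (fun j => Real.log (m (s j))) (t N)
    (fun j => by rw [← htj j j.2]; exact hmax N le_rfl j (by omega))
    (by rw [hsum]; push_cast; exact key)
  simp only [decay]
  rw [← Real.exp_sum, Finset.sum_sub_distrib, Finset.sum_neg_distrib, ← Finset.mul_sum]
  exact Real.one_le_exp (by linarith)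

theorem volume_lt_top {F : MvPolynomial (Fin n) ℤ} {L : Fin d → Fin n → ℂ} (hn : 1 ≤ n)
    (hd : 1 ≤ d) (hF0 : F ≠ 0) (hL : IsFactorization F L) (hJ : (J L).Nonempty) {r : ℝ}
    (hr0 : 0 < r) (hrd : r * n < d)
    (hr : ∀ s ∈ J L, ∀ j, 1 ≤ j → j < n → (countIn L (prefixSpan L s j) : ℝ) ≤ r * j) :
    V F < ⊤ := by
  have hL0 := ne_zero_of_isFactorization hF0 hL
  obtain ⟨s₀, hs₀⟩ := hJ
  obtain ⟨η, hη0, hη1, hη⟩ := exists_sum_le_neg_mul_sum_abs n hn (sub_pos.mpr hrd) hr0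
  have hM : ∀ s : Fin n → Fin d, ∃ M : Matrix (Fin n) (Fin n) ℝ, s ∈ J L → M.det ≠ 0 ∧
      ∀ j, (M j = fun k => (L (s j) k).re) ∨ (M j = fun k => (L (s j) k).im) := by
    intro s
    by_cases hs : s ∈ J L
    · obtain ⟨M, hM⟩ := exists_re_or_im_det_ne_zero (linearIndependent_of_mem_J hs)
      exact ⟨M, fun _ => hM⟩
    · exact ⟨0, fun h => absurd h hs⟩
  choose M hM using hM
  set G : (Fin n → ℝ) → ℝ := fun x =>
    ∑ s ∈ J L, ∏ j, decay η (scale L (s j) * (M s).mulVec x j) with hG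
  have hGint : Integrable G := by
    refine integrable_finsetSum _ fun s hs => ?_
    exact integrable_prod_comp_mulVec (g := fun j y => decay η (scale L (s j) * y))
      (fun j => (integrable_decay hη0).comp_mul_left' (scale_pos hL0 _).ne') (hM s hs).1
  have hne : ∀ᵐ x : Fin n → ℝ, ∀ i, pairing (L i) x ≠ 0 := by
    rw [ae_all_iff]
    intro i
    simpa [ae_iff] using volume_pairing_eq_zero (hL0 i)
  -- The real coordinates must be nonzero for `decay_antitone`; this excludes finitely many
  -- hyperplanes.
  have hne' : ∀ᵐ x : Fin n → ℝ, ∀ s (_ : s ∈ J L) j, (M s).mulVec x j ≠ 0 := by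
    rw [ae_all_iff]
    intro s
    by_cases hs : s ∈ J L
    · simp only [hs, true_implies]
      rw [ae_all_iff]
      intro j
      have hv : (fun k => (M s j k : ℂ)) ≠ 0 := by
        intro h0
        apply (hM s hs).1
        refine Matrix.det_eq_zero_of_row_eq_zero j fun k => ?_
        simpa using congrFun h0 k
      have := volume_pairing_eq_zero hv
      rw [ae_iff]
      convert this using 5 with x
      simp only [not_not, pairing, Matrix.mulVec, dotProduct]
      norm_cast
    · simp [hs]
  refine lt_of_le_of_lt (measure_mono_ae ?_) (hGint.measure_ge_lt_top one_pos)
  filter_upwards [hne, hne'] with x hx hx' hxV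
  change |aeval x F| ≤ 1 at hxV
  change 1 ≤ G x
  set m : Fin d → ℝ := fun i => scale L i * ‖pairing (L i) x‖ with hm
  have hm0 : ∀ i, 0 < m i := fun i => mul_pos (scale_pos hL0 i) (norm_pos_iff.mpr (hx i))
  obtain ⟨s, hs, hle⟩ := exists_greedy_mem_J hd m hL0 (exists_eq_smul_conjVec hF0 hL)
    (span_range_eq_top hs₀) (fun i i' c h => scale_mul_norm_pairing_eq hL0 h x)
  have h1 : 1 ≤ ∏ j, decay η (m (s j)) := by
    refine one_le_prod_decay hs hL0 hm0 ?_ hle hn (hr s hs) hη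
    simp only [hm]
    rw [Finset.prod_mul_distrib, prod_scale hd hL0, one_mul, ← abs_aeval_eq_prod hL]
    exact hxV
  -- A real or imaginary part is no larger than the modulus, and `decay` decreases in absolute
  -- value.
  have h2 : ∏ j, decay η (m (s j)) ≤ ∏ j, decay η (scale L (s j) * (M s).mulVec x j) := by
    refine Finset.prod_le_prod (fun j _ => (Real.exp_pos _).le) fun j _ => ?_
    refine decay_antitone hη0.le hη1 (mul_ne_zero (scale_pos hL0 _).ne' (hx' s hs j)) ?_
    rw [abs_mul, hm, abs_mul, abs_norm]
    refine mul_le_mul_of_nonneg_left ?_ (abs_nonneg _)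
    rcases (hM s hs).2 j with h | h
    · have : (M s).mulVec x j = (pairing (L (s j)) x).re := by
        rw [pairing_re, Matrix.mulVec, h]; rfl
      rw [this]
      exact Complex.abs_re_le_norm _
    · have : (M s).mulVec x j = (pairing (L (s j)) x).im := by
        rw [pairing_im, Matrix.mulVec, h]; rfl
      rw [this]
      exact Complex.abs_im_le_norm _
  refine (h1.trans h2).trans ?_
  exact Finset.single_le_sum
    (f := fun s => ∏ j, decay η (scale L (s j) * (M s).mulVec x j))
    (fun s _ => Finset.prod_nonneg fun j _ => (Real.exp_pos _).le) hs

/-! ### Infinite volume from a conjugation-invariant subspace -/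

/-- The real vectors in `W`. -/
def realPoints (W : Submodule ℂ (Fin n → ℂ)) : Submodule ℝ (Fin n → ℝ) where
  carrier := {w | (fun j => (w j : ℂ)) ∈ W}
  add_mem' {v w} hv hw := by
    have := W.add_mem hv hw
    simp only [Set.mem_ofPred_eq, Pi.add_apply, Complex.ofReal_add]
    exact this
  zero_mem' := by
    simp only [Set.mem_ofPred_eq, Pi.zero_apply, Complex.ofReal_zero]
    exact W.zero_mem
  smul_mem' c v hv := by
    have := W.smul_mem (c : ℂ) hv
    simp only [Set.mem_ofPred_eq, Pi.smul_apply, smul_eq_mul, Complex.ofReal_mul]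
    exact this

theorem mem_realPoints {W : Submodule ℂ (Fin n → ℂ)} {w : Fin n → ℝ} :
    w ∈ realPoints W ↔ (fun j => (w j : ℂ)) ∈ W := Iff.rfl

theorem re_mem_realPoints {W : Submodule ℂ (Fin n → ℂ)} (hW : W ≤ conjSubmodule W)
    {v : Fin n → ℂ} (hv : v ∈ W) : (fun j => (v j).re) ∈ realPoints W := by
  rw [mem_realPoints]
  have h := W.smul_mem (1 / 2 : ℂ) (W.add_mem hv (hW hv))
  convert h using 1
  ext j
  simp only [Pi.smul_apply, Pi.add_apply, conjVec, smul_eq_mul, Complex.add_conj]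
  push_cast
  ring

theorem im_mem_realPoints {W : Submodule ℂ (Fin n → ℂ)} (hW : W ≤ conjSubmodule W)
    {v : Fin n → ℂ} (hv : v ∈ W) : (fun j => (v j).im) ∈ realPoints W := by
  have h := re_mem_realPoints hW (W.smul_mem (-Complex.I) hv)
  simpa using h

/-- Real vectors independent over `ℝ` stay independent over `ℂ`: split a complex relation into real
and imaginary parts. -/
theorem finrank_realPoints_le (W : Submodule ℂ (Fin n → ℂ)) :
    Module.finrank ℝ (realPoints W) ≤ Module.finrank ℂ W := by
  set b := Module.finBasis ℝ (realPoints W)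
  let v : Fin (Module.finrank ℝ (realPoints W)) → W :=
    fun k => ⟨fun j => ((b k : Fin n → ℝ) j : ℂ), (b k).2⟩
  have hb : LinearIndependent ℝ fun k => (b k : Fin n → ℝ) :=
    b.linearIndependent.map' (realPoints W).subtype (Submodule.ker_subtype _)
  have hv : LinearIndependent ℂ v := by
    rw [Fintype.linearIndependent_iff] at hb ⊢
    intro g hg k
    have hg' : ∀ j, ∑ k, g k * ((b k : Fin n → ℝ) j : ℂ) = 0 := by
      intro j
      have := congrFun (congrArg Subtype.val hg) j
      simpa [v] using this
    apply Complex.ext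
    · refine hb (fun k => (g k).re) ?_ k
      ext j
      have := congrArg Complex.re (hg' j)
      simpa using this
    · refine hb (fun k => (g k).im) ?_ k
      ext j
      have := congrArg Complex.im (hg' j)
      simpa using this
  simpa using hv.fintype_card_le_finrank

/-- Real and imaginary parts of vectors of an invariant `W` lie in `realPoints W`. A basis of that
space, indexed by `A`, is completed by a basis of a real complement. -/
theorem exists_adapted_basis {W : Submodule ℂ (Fin n → ℂ)} (hW : W ≤ conjSubmodule W)
    (hbot : W ≠ ⊥) (htop : W ≠ ⊤) :
    ∃ (b : Module.Basis (Fin n) ℝ (Fin n → ℝ)) (A : Finset (Fin n)), A.Nonempty ∧ Aᶜ.Nonempty ∧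
      A.card ≤ Module.finrank ℂ W ∧ ∀ w ∈ realPoints W, ∀ a ∉ A, b.repr w a = 0 := by
  classical
  set U := realPoints W with hU
  obtain ⟨U', hU'⟩ := U.exists_isCompl
  have hfr : Module.finrank ℝ U + Module.finrank ℝ U' = n := by
    rw [Submodule.finrank_add_eq_of_isCompl hU', Module.finrank_fin_fun]
  set b₀ := ((Module.finBasis ℝ U).prod (Module.finBasis ℝ U')).map
    (Submodule.prodEquivOfIsCompl U U' hU') with hb₀
  set e := finSumFinEquiv.trans (finCongr hfr) with he
  refine ⟨b₀.reindex e, Finset.univ.map (Function.Embedding.inl.trans e.toEmbedding), ?_, ?_, ?_, ?_⟩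
  · have hpos : 0 < Module.finrank ℝ U := by
      rw [Module.finrank_pos_iff, Submodule.nontrivial_iff_ne_bot]
      intro h
      apply hbot
      rw [Submodule.eq_bot_iff]
      intro v hv
      have h1 := re_mem_realPoints hW hv
      have h2 := im_mem_realPoints hW hv
      rw [← hU, h, Submodule.mem_bot] at h1 h2
      ext j
      exact Complex.ext (congrFun h1 j) (congrFun h2 j)
    exact ⟨e (Sum.inl ⟨0, hpos⟩), by simp⟩
  · have hpos : 0 < Module.finrank ℝ U' := by
      rw [Module.finrank_pos_iff, Submodule.nontrivial_iff_ne_bot]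
      rintro rfl
      have hUtop : U = ⊤ := by simpa using hU'.sup_eq_top
      apply htop
      rw [Submodule.eq_top_iff']
      intro v
      have h1 : (fun j => (v j).re) ∈ realPoints W := by rw [← hU, hUtop]; trivial
      have h2 : (fun j => (v j).im) ∈ realPoints W := by rw [← hU, hUtop]; trivial
      rw [mem_realPoints] at h1 h2
      have := W.add_mem h1 (W.smul_mem Complex.I h2)
      convert this using 1
      ext j
      simp only [Pi.add_apply, Pi.smul_apply, smul_eq_mul]
      rw [mul_comm, Complex.re_add_im]
    exact ⟨e (Sum.inr ⟨0, hpos⟩), by simp⟩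
  · simpa using finrank_realPoints_le W
  · intro w hw a ha
    obtain ⟨c, rfl⟩ := e.surjective a
    rw [Module.Basis.repr_reindex_apply, Equiv.symm_apply_apply, hb₀, Module.Basis.map_repr,
      LinearEquiv.trans_apply]
    have hsymm : (Submodule.prodEquivOfIsCompl U U' hU').symm w = (⟨w, hw⟩, 0) := by
      rw [LinearEquiv.symm_apply_eq]
      simp
    rw [hsymm]
    rcases c with c | c
    · exact absurd (by simp) ha
    · simp

theorem sum_mul_eq_sum_repr_mul (b : Module.Basis (Fin n) ℝ (Fin n → ℝ)) (w x : Fin n → ℝ) :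
    ∑ j, w j * x j = ∑ a, b.repr w a * (Matrix.of fun a => b a).mulVec x a := by
  have h : ∀ j, w j = ∑ a, b.repr w a * b a j := by
    intro j
    have := congrFun (b.sum_repr w) j
    simpa using this.symm
  calc ∑ j, w j * x j = ∑ j, ∑ a, b.repr w a * b a j * x j := by
        refine Finset.sum_congr rfl fun j _ => ?_
        rw [← Finset.sum_mul, ← h]
    _ = _ := by
        rw [Finset.sum_comm]
        refine Finset.sum_congr rfl fun a _ => ?_
        simp only [Matrix.mulVec, dotProduct, Matrix.of_apply, Finset.mul_sum, mul_assoc]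

theorem norm_pairing_le (b : Module.Basis (Fin n) ℝ (Fin n → ℝ)) (v : Fin n → ℂ)
    (x : Fin n → ℝ) {Y : ℝ}
    (hY : ∀ a, b.repr (fun j => (v j).re) a = 0 ∧ b.repr (fun j => (v j).im) a = 0 ∨
      |(Matrix.of fun a => b a).mulVec x a| ≤ Y) :
    ‖pairing v x‖ ≤
      (∑ a, (|b.repr (fun j => (v j).re) a| + |b.repr (fun j => (v j).im) a|)) * Y := by
  refine (Complex.norm_le_abs_re_add_abs_im _).trans ?_
  rw [pairing_re, pairing_im, sum_mul_eq_sum_repr_mul b (fun j => (v j).re),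
    sum_mul_eq_sum_repr_mul b (fun j => (v j).im), Finset.sum_mul]
  refine (add_le_add (Finset.abs_sum_le_sum_abs _ _) (Finset.abs_sum_le_sum_abs _ _)).trans ?_
  rw [← Finset.sum_add_distrib]
  refine Finset.sum_le_sum fun a _ => ?_
  rw [abs_mul, abs_mul, ← add_mul]
  rcases hY a with ⟨h1, h2⟩ | h
  · simp [h1, h2]
  · exact mul_le_mul_of_nonneg_left h (by positivity)

/-- A box of volume `ε ^ n` that is short in the directions in `A` and long in the others. -/
def box (A : Finset (Fin n)) (ε : ℝ) (k : ℕ) : Set (Fin n → ℝ) :=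
  Set.univ.pi fun a => if a ∈ A then Set.Ioo 0 (ε * ((2 : ℝ) ^ (Aᶜ.card * k))⁻¹)
    else Set.Ioo (ε * 2 ^ (A.card * k)) (2 * (ε * 2 ^ (A.card * k)))

theorem measurableSet_box (A : Finset (Fin n)) (ε : ℝ) (k : ℕ) : MeasurableSet (box A ε k) := by
  refine MeasurableSet.univ_pi fun a => ?_
  split_ifs <;> exact measurableSet_Ioo

theorem volume_box (A : Finset (Fin n)) {ε : ℝ} (hε : 0 < ε) (k : ℕ) :
    volume (box A ε k) = ENNReal.ofReal (ε ^ n) := by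
  rw [box, volume_pi_pi]
  have h : ∀ a, volume (if a ∈ A then Set.Ioo 0 (ε * ((2 : ℝ) ^ (Aᶜ.card * k))⁻¹)
      else Set.Ioo (ε * 2 ^ (A.card * k)) (2 * (ε * 2 ^ (A.card * k)))) =
      ENNReal.ofReal (ε * if a ∈ A then ((2 : ℝ) ^ (Aᶜ.card * k))⁻¹ else 2 ^ (A.card * k)) := by
    intro a
    split_ifs
    · rw [Real.volume_Ioo, sub_zero]
    · rw [Real.volume_Ioo]
      congr 1
      ring
  simp only [h]
  rw [← ENNReal.ofReal_prod_of_nonneg]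
  · congr 1
    rw [Finset.prod_mul_distrib, Finset.prod_ite, Finset.prod_const, Finset.prod_const,
      Finset.prod_const]
    have h1 : (Finset.univ.filter fun a => a ∈ A).card = A.card := by simp
    have h2 : (Finset.univ.filter fun a => a ∉ A).card = Aᶜ.card := by
      congr 1; ext; simp
    rw [h1, h2, inv_pow, ← pow_mul, ← pow_mul]
    have h3 : Aᶜ.card * k * A.card = A.card * k * Aᶜ.card := by ring
    rw [h3, inv_mul_cancel₀ (by positivity)]
    simp
  · intro a _
    split_ifs <;> positivity

theorem disjoint_box {A : Finset (Fin n)} (hA : A.Nonempty) (hA' : Aᶜ.Nonempty) {ε : ℝ}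
    (hε : 0 < ε) {k l : ℕ} (hkl : k < l) : Disjoint (box A ε k) (box A ε l) := by
  obtain ⟨a, ha⟩ := hA'
  rw [Finset.mem_compl] at ha
  rw [Set.disjoint_left]
  intro y hy hy'
  have h1 := hy a trivial
  have h2 := hy' a trivial
  simp only [if_neg ha, Set.mem_Ioo] at h1 h2
  -- As `A` is nonempty, the exponent grows strictly with the index, so the long sides `(R, 2R)` do
  -- not overlap.
  have h3 : A.card * k + 1 ≤ A.card * l := by
    have := Finset.card_pos.mpr hA
    nlinarith
  have h4 : (2 : ℝ) * 2 ^ (A.card * k) ≤ 2 ^ (A.card * l) := by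
    rw [← pow_succ']
    exact pow_le_pow_right₀ (by norm_num) h3
  nlinarith [h1.2, h2.1]

theorem prod_pow_le_one {p q c k : ℕ} (h : (p + q) * c ≥ p * d) (hc : c ≤ d) :
    (((2 : ℝ) ^ (q * k))⁻¹) ^ c * ((2 : ℝ) ^ (p * k)) ^ (d - c) ≤ 1 := by
  rw [inv_pow, ← pow_mul, ← pow_mul, inv_mul_le_iff₀ (by positivity), mul_one]
  refine pow_le_pow_right₀ (by norm_num) ?_
  obtain ⟨e, rfl⟩ := Nat.exists_eq_add_of_le hc
  rw [Nat.add_sub_cancel_left]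
  have : p * e ≤ q * c := by nlinarith
  calc p * k * e = k * (p * e) := by ring
    _ ≤ k * (q * c) := Nat.mul_le_mul_left _ this
    _ = q * k * c := by ring

/-- On the `k`-th box, forms in `W` see only short coordinates and are at most `2 ^ (-|Aᶜ| k)`; the
others are at most `2 ^ (|A| k)`. The counting hypothesis makes the product at most `1`, uniformly
in `k`. -/
theorem volume_eq_top {F : MvPolynomial (Fin n) ℤ} {L : Fin d → Fin n → ℂ}
    (hL : IsFactorization F L) {W : Submodule ℂ (Fin n → ℂ)} (hW : W ≤ conjSubmodule W)
    (hbot : W ≠ ⊥) (htop : W ≠ ⊤) (hc : Module.finrank ℂ W * d ≤ n * countIn L W) :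
    V F = ⊤ := by
  classical
  obtain ⟨b, A, hA, hA', hAcard, hrepr⟩ := exists_adapted_basis hW hbot htop
  set M : Matrix (Fin n) (Fin n) ℝ := Matrix.of fun a => b a with hM
  have hdet : M.det ≠ 0 := by
    have := Matrix.linearIndependent_rows_iff_isUnit (A := M) |>.mp b.linearIndependent
    exact ((Matrix.isUnit_iff_isUnit_det _).mp this).ne_zero
  set κ : Fin d → ℝ := fun i =>
    ∑ a, (|b.repr (fun j => (L i j).re) a| + |b.repr (fun j => (L i j).im) a|) with hκ
  have hκ0 : ∀ i, 0 ≤ κ i := fun i => Finset.sum_nonneg fun a _ => by positivity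
  set K : ℝ := ∑ i, κ i + 1 with hK
  have hKpos : 0 < K := by
    have := Finset.sum_nonneg fun i (_ : i ∈ Finset.univ) => hκ0 i
    linarith
  have hκK : ∀ i, κ i ≤ K := fun i => by
    have := Finset.single_le_sum (fun i _ => hκ0 i) (Finset.mem_univ i)
    linarith
  -- `K` bounds the coefficient sum of every form and box coordinates reach `2 * ε` times the scale,
  -- so this `ε` absorbs all constants.
  set ε : ℝ := 1 / (2 * K) with hε
  have hεpos : 0 < ε := by positivity
  have hKε : K * (2 * ε) = 1 := by rw [hε]; field_simp
  have hcard : A.card + Aᶜ.card = n := by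
    rw [Finset.card_add_card_compl, Fintype.card_fin]
  have hmem : ∀ k, M.mulVec ⁻¹' box A ε k ⊆ {x | |aeval x F| ≤ 1} := by
    intro k x hx
    have hshort : ∀ a ∈ A, |M.mulVec x a| ≤ ε * ((2 : ℝ) ^ (Aᶜ.card * k))⁻¹ := by
      intro a ha
      have h := hx a trivial
      simp only [if_pos ha, Set.mem_Ioo] at h
      rw [abs_of_pos h.1]
      exact h.2.le
    have hlong : ∀ a, |M.mulVec x a| ≤ 2 * ε * 2 ^ (A.card * k) := by
      intro a
      by_cases ha : a ∈ A
      · refine (hshort a ha).trans ?_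
        have h1 : ((2 : ℝ) ^ (Aᶜ.card * k))⁻¹ ≤ 1 :=
          inv_le_one_of_one_le₀ (one_le_pow₀ (by norm_num))
        have h2 : (1 : ℝ) ≤ 2 ^ (A.card * k) := one_le_pow₀ (by norm_num)
        nlinarith
      · have h := hx a trivial
        simp only [if_neg ha, Set.mem_Ioo] at h
        have h0 : 0 < ε * 2 ^ (A.card * k) := by positivity
        rw [abs_of_pos (h0.trans h.1)]
        linarith [h.2]
    have hfac : ∀ i, ‖pairing (L i) x‖ ≤
        if L i ∈ W then ((2 : ℝ) ^ (Aᶜ.card * k))⁻¹ else 2 ^ (A.card * k) := by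
      intro i
      split_ifs with hi
      · have h := norm_pairing_le b (L i) x (Y := ε * ((2 : ℝ) ^ (Aᶜ.card * k))⁻¹) fun a => by
          by_cases ha : a ∈ A
          · exact Or.inr (hshort a ha)
          · exact Or.inl ⟨hrepr _ (re_mem_realPoints hW hi) a ha,
              hrepr _ (im_mem_realPoints hW hi) a ha⟩
        refine h.trans ?_
        have h1 : 0 < ((2 : ℝ) ^ (Aᶜ.card * k))⁻¹ := by positivity
        rw [← mul_assoc]
        refine mul_le_of_le_one_left h1.le ?_
        calc κ i * ε ≤ K * ε := mul_le_mul_of_nonneg_right (hκK i) hεpos.le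
          _ ≤ 1 := by nlinarith
      · have h := norm_pairing_le b (L i) x fun a => Or.inr (hlong a)
        refine h.trans ?_
        rw [← mul_assoc]
        refine mul_le_of_le_one_left (by positivity) ?_
        calc κ i * (2 * ε) ≤ K * (2 * ε) := mul_le_mul_of_nonneg_right (hκK i) (by positivity)
          _ ≤ 1 := hKε.le
    change |aeval x F| ≤ 1
    rw [abs_aeval_eq_prod hL]
    refine (Finset.prod_le_prod (fun i _ => norm_nonneg _) fun i _ => hfac i).trans ?_
    rw [Finset.prod_ite, Finset.prod_const, Finset.prod_const]
    have h1 : (Finset.univ.filter fun i => L i ∈ W).card = countIn L W := by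
      simp only [countIn]
    have h2 : (Finset.univ.filter fun i => L i ∉ W).card = d - countIn L W := by
      rw [← h1, ← Finset.compl_filter, Finset.card_compl, Fintype.card_fin]
    have hcd : countIn L W ≤ d := by
      rw [← h1]
      exact (Finset.card_le_univ _).trans (by simp)
    rw [h1, h2]
    refine prod_pow_le_one ?_ hcd
    rw [hcard]
    exact (Nat.mul_le_mul_right d hAcard).trans hc
  have hmeas : Measurable (M.mulVec : (Fin n → ℝ) → Fin n → ℝ) :=
    (LinearMap.continuous_of_finiteDimensional (Matrix.toLin' M)).measurable
  have hvol : ∀ k, volume (M.mulVec ⁻¹' box A ε k) =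
      ENNReal.ofReal |M.det⁻¹| * ENNReal.ofReal (ε ^ n) := by
    intro k
    have h := congrArg (fun μ => μ (box A ε k)) (Real.map_matrix_volume_pi_eq_smul_volume_pi hdet)
    simp only [Measure.smul_apply, smul_eq_mul, volume_box A hεpos] at h
    rw [← h]
    exact (Measure.map_apply hmeas (measurableSet_box A ε k)).symm
  by_contra hfin
  have hpos : 0 < ENNReal.ofReal |M.det⁻¹| * ENNReal.ofReal (ε ^ n) := by
    refine ENNReal.mul_pos ?_ ?_
    · simpa using hdet
    · simpa using pow_pos hεpos n
  have := Measure.finite_const_le_meas_of_disjoint_iUnion volume hpos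
    (As := fun k => M.mulVec ⁻¹' box A ε k) (fun k => hmeas (measurableSet_box A ε k))
    (fun k l hkl => by
      refine Disjoint.preimage _ ?_
      rcases lt_or_gt_of_ne hkl with h | h
      · exact disjoint_box hA hA' hεpos h
      · exact (disjoint_box hA hA' hεpos h).symm)
    (ne_top_of_le_ne_top hfin (measure_mono (Set.iUnion_subset hmem)))
  simp only [hvol, le_refl] at this
  exact Set.infinite_univ (this.subset fun _ _ => trivial)

/-! ### Counting forms in subspaces, and prefix spans of tuples in `J` -/

theorem countIn_le (L : Fin d → Fin n → ℂ) (S : Submodule ℂ (Fin n → ℂ)) : countIn L S ≤ d := by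
  classical
  exact (Finset.card_le_univ _).trans (by simp)

open scoped Classical in
theorem countIn_add_le {L : Fin d → Fin n → ℂ} {S T A B : Submodule ℂ (Fin n → ℂ)}
    (hA : S ⊓ T ≤ A) (hS : S ≤ B) (hT : T ≤ B) :
    countIn L S + countIn L T ≤ countIn L A + countIn L B := by
  unfold countIn
  rw [← Finset.card_union_add_card_inter, add_comm]
  refine add_le_add (Finset.card_le_card fun i hi => ?_) (Finset.card_le_card fun i hi => ?_)
  · simp only [Finset.mem_inter, Finset.mem_filter, Finset.mem_univ, true_and] at hi ⊢
    exact hA ⟨hi.1, hi.2⟩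
  · simp only [Finset.mem_union, Finset.mem_filter, Finset.mem_univ, true_and] at hi ⊢
    exact hi.elim (fun h => hS h) fun h => hT h

theorem countIn_bot {L : Fin d → Fin n → ℂ} (hL0 : ∀ i, L i ≠ 0) : countIn L ⊥ = 0 := by
  classical
  simp [countIn, hL0]

theorem prefixSpan_succ (L : Fin d → Fin n → ℂ) (s : Fin n → Fin d) {k : ℕ} (hk : k < n) :
    prefixSpan L s (k + 1) = prefixSpan L s k ⊔ Submodule.span ℂ {L (s ⟨k, hk⟩)} := by
  rw [prefixSpan, prefixSpan, ← Submodule.span_union]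
  congr 1
  have : {t : Fin n | (t : ℕ) < k + 1} = {t : Fin n | (t : ℕ) < k} ∪ {⟨k, hk⟩} := by
    ext t
    simp only [Set.mem_ofPred_eq, Set.mem_union, Set.mem_singleton_iff, Fin.ext_iff]
    omega
  rw [this, Set.image_union, Set.image_singleton]

theorem finrank_sup_span_singleton_le (S : Submodule ℂ (Fin n → ℂ)) (v : Fin n → ℂ) :
    Module.finrank ℂ ↥(S ⊔ Submodule.span ℂ {v}) ≤ Module.finrank ℂ S + 1 :=
  (Submodule.finrank_add_le_finrank_add_finrank _ _).trans
    (Nat.add_le_add_left ((finrank_span_le_card ({v} : Set (Fin n → ℂ))).trans (by simp)) _)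

theorem finrank_prefixSpan_le (L : Fin d → Fin n → ℂ) (s : Fin n → Fin d) :
    ∀ {k : ℕ}, k ≤ n → Module.finrank ℂ (prefixSpan L s k) ≤ k
  | 0, _ => by rw [prefixSpan_zero, finrank_bot]
  | k + 1, hk => by
    rw [prefixSpan_succ L s hk]
    exact (finrank_sup_span_singleton_le _ _).trans
      (Nat.add_le_add_right (finrank_prefixSpan_le L s (Nat.le_of_succ_le hk)) 1)

/-- If a prefix span is not invariant but its predecessor is, the conjugate of its last vector is
missing from it. The defining condition of `J` then forces the next vector to be proportional to
that conjugate, which restores invariance. -/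
theorem conj_invariant_of_mem_J {L : Fin d → Fin n → ℂ} {s : Fin n → Fin d} (hs : s ∈ J L) :
    ∀ j ≤ n, prefixSpan L s j ≤ conjSubmodule (prefixSpan L s j) ∨
      ∃ k, j = k + 1 ∧ prefixSpan L s k ≤ conjSubmodule (prefixSpan L s k) := by
  intro j
  induction j with
  | zero => intro _; left; rw [prefixSpan_zero]; exact bot_le
  | succ j ih =>
    intro hj
    by_cases h : prefixSpan L s j ≤ conjSubmodule (prefixSpan L s j)
    · exact Or.inr ⟨j, rfl, h⟩
    · left
      obtain ⟨k, rfl, hk⟩ := (ih (by omega)).resolve_left h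
      have hkn : k + 1 < n := by omega
      have hsuc := prefixSpan_succ L s (Nat.lt_of_succ_lt hkn)
      have hv : conjVec (L (s ⟨k, Nat.lt_of_succ_lt hkn⟩)) ∉ prefixSpan L s (k + 1) := by
        intro hv
        apply h
        conv_lhs => rw [hsuc]
        refine sup_le (hk.trans (conjSubmodule_mono (prefixSpan_mono L s (Nat.le_succ k)))) ?_
        rwa [Submodule.span_singleton_le_iff_mem]
      have hJ := hs
      simp only [J, Finset.mem_filter] at hJ
      obtain ⟨c, hc⟩ := (hJ.2 k hkn).resolve_right hv
      have hc0 : c ≠ 0 := by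
        rintro rfl
        exact (linearIndependent_of_mem_J hs).ne_zero ⟨k + 1, hkn⟩ (by simpa using hc)
      have hw := mem_prefixSpan L s (j := k + 1 + 1) ⟨k + 1, hkn⟩ (by simp)
      have hv' := mem_prefixSpan L s (j := k + 1 + 1) ⟨k, Nat.lt_of_succ_lt hkn⟩
        (by simp)
      conv_lhs => rw [prefixSpan_succ L s hkn, hsuc]
      refine sup_le (sup_le (hk.trans (conjSubmodule_mono (prefixSpan_mono L s (by omega)))) ?_) ?_
      · rw [Submodule.span_singleton_le_iff_mem, mem_conjSubmodule]
        rw [hc] at hw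
        exact (Submodule.smul_mem_iff _ hc0).mp hw
      · rw [Submodule.span_singleton_le_iff_mem, mem_conjSubmodule, hc, conjVec_smul,
          conjVec_conjVec]
        exact Submodule.smul_mem _ _ hv'

/-! ### The exceptional case of binary quadratic forms -/

/-- The real quadratic form `|v₁ X₁ + ⋯ + vₙ Xₙ|²`. -/
noncomputable def normSqForm (v : Fin n → ℂ) : MvPolynomial (Fin n) ℝ :=
  (∑ j, C (v j).re * X j) ^ 2 + (∑ j, C (v j).im * X j) ^ 2

theorem isHomogeneous_normSqForm (v : Fin n → ℂ) : (normSqForm v).IsHomogeneous 2 := by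
  have h : ∀ w : Fin n → ℝ, (∑ j, C (w j) * X j : MvPolynomial (Fin n) ℝ).IsHomogeneous 1 :=
    fun w => IsHomogeneous.sum _ _ _ fun j _ => by
      simpa using (isHomogeneous_C _ (w j)).mul (isHomogeneous_X ℝ j)
  exact ((h fun j => (v j).re).pow 2).add ((h fun j => (v j).im).pow 2)

theorem map_normSqForm (v : Fin n → ℂ) :
    map Complex.ofRealHom (normSqForm v) = linearForm v * linearForm (conjVec v) := by
  set A : MvPolynomial (Fin n) ℂ := ∑ j, C ((v j).re : ℂ) * X j with hA
  set B : MvPolynomial (Fin n) ℂ := ∑ j, C ((v j).im : ℂ) * X j with hB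
  have h1 : linearForm v = A + C Complex.I * B := by
    rw [linearForm, hA, hB, Finset.mul_sum, ← Finset.sum_add_distrib]
    refine Finset.sum_congr rfl fun j _ => ?_
    rw [← mul_assoc, ← C_mul, ← add_mul, ← C_add, mul_comm Complex.I, Complex.re_add_im]
  have h2 : linearForm (conjVec v) = A - C Complex.I * B := by
    rw [linearForm, hA, hB, Finset.mul_sum, ← Finset.sum_sub_distrib]
    refine Finset.sum_congr rfl fun j _ => ?_
    rw [← mul_assoc, ← C_mul, ← sub_mul, ← C_sub, conjVec]
    congr 2
    apply Complex.ext <;> simp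
  have h3 : map Complex.ofRealHom (normSqForm v) = A ^ 2 + B ^ 2 := by
    simp [normSqForm, hA, hB]
  have h4 : (C Complex.I : MvPolynomial (Fin n) ℂ) * C Complex.I = -1 := by
    rw [← C_mul, Complex.I_mul_I, C_neg, C_1]
  rw [h1, h2, h3]
  linear_combination B ^ 2 * h4

theorem eval_normSqForm (v : Fin n → ℂ) (x : Fin n → ℝ) :
    eval x (normSqForm v) = ‖pairing v x‖ ^ 2 := by
  rw [← Complex.normSq_eq_norm_sq, Complex.normSq_apply, pairing_re, pairing_im]
  simp [normSqForm, sq]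

/-- At least half of the forms lie on the line of `v` and equally many on the distinct conjugate
line, so these are all of them. Pairing them off makes `F` a constant times a power of `normSqForm
v`, definite because `v` and `conjVec v` span. -/
theorem isPosDefBinaryPower_of_countIn {F : MvPolynomial (Fin n) ℤ} {L : Fin d → Fin n → ℂ}
    (hn : n = 2) (hd : 1 ≤ d) (hF0 : F ≠ 0) (hL : IsFactorization F L) {v : Fin n → ℂ}
    (hinf : Submodule.span ℂ {v} ⊓ Submodule.span ℂ {conjVec v} = ⊥)
    (hsup : Submodule.span ℂ {v} ⊔ Submodule.span ℂ {conjVec v} = ⊤)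
    (hc : d ≤ 2 * countIn L (Submodule.span ℂ {v}))
    (hc' : countIn L (Submodule.span ℂ {conjVec v}) = countIn L (Submodule.span ℂ {v})) :
    IsPosDefBinaryPower F := by
  classical
  have hL0 := ne_zero_of_isFactorization hF0 hL
  set k := countIn L (Submodule.span ℂ {v}) with hk
  set P := Finset.univ.filter fun i => L i ∈ Submodule.span ℂ {v} with hP
  set Q := Finset.univ.filter fun i => L i ∈ Submodule.span ℂ {conjVec v} with hQ
  have hPk : P.card = k := by simp only [hk, countIn, hP]
  have hQk : Q.card = k := by rw [← hc']; simp only [countIn, hQ]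
  have hdisj : Disjoint P Q := by
    rw [Finset.disjoint_left]
    intro i hi hi'
    simp only [hP, hQ, Finset.mem_filter, Finset.mem_univ, true_and] at hi hi'
    have : L i ∈ Submodule.span ℂ {v} ⊓ Submodule.span ℂ {conjVec v} := ⟨hi, hi'⟩
    rw [hinf, Submodule.mem_bot] at this
    exact hL0 i this
  have hcard : (P ∪ Q).card = 2 * k := by
    rw [Finset.card_union_of_disjoint hdisj, hPk, hQk]; ring
  have huniv : P ∪ Q = Finset.univ := by
    apply Finset.eq_univ_of_card
    have := Finset.card_le_univ (P ∪ Q)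
    rw [Fintype.card_fin] at this ⊢
    omega
  have hPe : ∀ i, ∃ e : ℂ, i ∈ P → L i = e • v := by
    intro i
    by_cases hi : i ∈ P
    · obtain ⟨e, he⟩ := Submodule.mem_span_singleton.mp (Finset.mem_filter.mp hi).2
      exact ⟨e, fun _ => he.symm⟩
    · exact ⟨0, fun h => absurd h hi⟩
  have hQe : ∀ i, ∃ e : ℂ, i ∈ Q → L i = e • conjVec v := by
    intro i
    by_cases hi : i ∈ Q
    · obtain ⟨e, he⟩ := Submodule.mem_span_singleton.mp (Finset.mem_filter.mp hi).2
      exact ⟨e, fun _ => he.symm⟩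
    · exact ⟨0, fun h => absurd h hi⟩
  choose e he using hPe
  choose e' he' using hQe
  obtain ⟨γ, hγ⟩ : ∃ γ : ℂ, map (Int.castRingHom ℂ) F =
      C γ * map Complex.ofRealHom (normSqForm v) ^ k := by
    refine ⟨(∏ i ∈ P, e i) * ∏ i ∈ Q, e' i, ?_⟩
    rw [hL, ← huniv, Finset.prod_union hdisj, map_normSqForm,
      Finset.prod_congr rfl fun i hi => by rw [he i hi, linearForm_smul],
      Finset.prod_congr (s₁ := Q) rfl fun i hi => by rw [he' i hi, linearForm_smul],
      Finset.prod_mul_distrib, Finset.prod_mul_distrib, Finset.prod_const, Finset.prod_const,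
      hPk, hQk, mul_pow, C_mul, map_prod, map_prod]
    ring
  have hpos : ∀ x : Fin n → ℝ, x ≠ 0 → 0 < eval x (normSqForm v) := by
    intro x hx
    rw [eval_normSqForm]
    refine pow_pos (norm_pos_iff.mpr fun h0 => hx ?_) 2
    have h0' : pairing (conjVec v) x = 0 := by rw [pairing_conjVec, h0, map_zero]
    ext j
    have hj : (Pi.single j 1 : Fin n → ℂ) ∈
        Submodule.span ℂ {v} ⊔ Submodule.span ℂ {conjVec v} := by rw [hsup]; trivial
    obtain ⟨y, hy, z, hz, hyz⟩ := Submodule.mem_sup.mp hj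
    obtain ⟨a, rfl⟩ := Submodule.mem_span_singleton.mp hy
    obtain ⟨b, rfl⟩ := Submodule.mem_span_singleton.mp hz
    have h1 : pairing (a • v + b • conjVec v) x = 0 := by
      have : pairing (a • v + b • conjVec v) x =
          pairing (a • v) x + pairing (b • conjVec v) x := by
        simp [pairing, add_mul, Finset.sum_add_distrib]
      rw [this, pairing_smul, pairing_smul, h0, h0', mul_zero, mul_zero, add_zero]
    rw [hyz] at h1
    simpa [pairing, Pi.single_apply] using h1
  have hFR : map (Int.castRingHom ℂ) F = map Complex.ofRealHom (map (Int.castRingHom ℝ) F) := by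
    rw [map_map]
    exact congrArg (fun f : ℤ →+* ℂ => map f F) (RingHom.ext_int _ _)
  have hinj : Function.Injective (map (σ := Fin n) Complex.ofRealHom) :=
    map_injective _ Complex.ofReal_injective
  -- The constant is real, being a quotient of real values at the point with all coordinates `1`.
  obtain ⟨c, rfl⟩ : ∃ c : ℝ, (c : ℂ) = γ := by
    set x : Fin n → ℝ := fun _ => 1 with hx
    have hx0 : x ≠ 0 := by
      intro h
      have := congrFun h ⟨0, by omega⟩
      simp [hx] at this
    have hev : ∀ p : MvPolynomial (Fin n) ℝ,
        eval (fun j => (x j : ℂ)) (map Complex.ofRealHom p) = ((eval x p : ℝ) : ℂ) := fun p => by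
      rw [eval_map, eval, eval₂Hom, RingHom.coe_mk, MonoidHom.coe_mk, OneHom.coe_mk]
      have := hom_eval₂ p (RingHom.id ℝ) Complex.ofRealHom x
      simpa using this.symm
    have h := congrArg (eval fun j => (x j : ℂ)) hγ
    rw [hFR, map_mul, map_pow, eval_C, hev, hev] at h
    have hq : ((eval x (normSqForm v) : ℝ) : ℂ) ^ k ≠ 0 :=
      pow_ne_zero _ (Complex.ofReal_ne_zero.mpr (hpos x hx0).ne')
    refine ⟨eval x (map (Int.castRingHom ℝ) F) / eval x (normSqForm v) ^ k, ?_⟩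
    rw [Complex.ofReal_div, Complex.ofReal_pow, div_eq_iff hq, h]
  have hF : map (Int.castRingHom ℝ) F = C c * normSqForm v ^ k := by
    apply hinj
    rw [← hFR, hγ]
    simp
  refine ⟨hn, normSqForm v, c, k, isHomogeneous_normSqForm v, hpos, ?_, by omega, hF⟩
  rintro rfl
  apply hF0
  apply map_injective (Int.castRingHom ℝ) Int.cast_injective
  rw [hF]
  simp

/-! ### Infinite volume when a ratio is large or the forms do not span -/

theorem volume_eq_top_of_mem_J {F : MvPolynomial (Fin n) ℤ} {L : Fin d → Fin n → ℂ}
    (hd : 1 ≤ d) (hF0 : F ≠ 0) (hF : ¬ IsPosDefBinaryPower F) (hL : IsFactorization F L)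
    {s : Fin n → Fin d} (hs : s ∈ J L) {j : ℕ} (hj : 1 ≤ j) (hjn : j < n)
    (hc : j * d ≤ n * countIn L (prefixSpan L s j)) : V F = ⊤ := by
  have hL0 := ne_zero_of_isFactorization hF0 hL
  have hbot : ∀ k, 1 ≤ k → prefixSpan L s k ≠ ⊥ := by
    intro k hk h
    have := mem_prefixSpan L s (j := k) ⟨0, by omega⟩ hk
    rw [h, Submodule.mem_bot] at this
    exact hL0 _ this
  have htop : ∀ k, k < n → prefixSpan L s k ≠ ⊤ := by
    intro k hk h
    apply notMem_prefixSpan hs (j := k) ⟨k, hk⟩ le_rfl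
    rw [h]; trivial
  by_cases hinv : prefixSpan L s j ≤ conjSubmodule (prefixSpan L s j)
  · exact volume_eq_top hL hinv (hbot j hj) (htop j hjn)
      ((Nat.mul_le_mul_right d (finrank_prefixSpan_le L s hjn.le)).trans hc)
  obtain ⟨k, rfl, hk⟩ := (conj_invariant_of_mem_J hs j hjn.le).resolve_left hinv
  have hkn : k < n := by omega
  set v := L (s ⟨k, hkn⟩) with hv
  have hsuc : prefixSpan L s (k + 1) = prefixSpan L s k ⊔ Submodule.span ℂ {v} :=
    prefixSpan_succ L s hkn
  have hvS : v ∈ prefixSpan L s (k + 1) := mem_prefixSpan L s ⟨k, hkn⟩ (by simp)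
  have hmono := prefixSpan_mono L s (Nat.le_succ k)
  have hcv : conjVec v ∉ prefixSpan L s (k + 1) := by
    intro h
    apply hinv
    conv_lhs => rw [hsuc]
    refine sup_le (hk.trans (conjSubmodule_mono hmono)) ?_
    rwa [Submodule.span_singleton_le_iff_mem]
  set B := prefixSpan L s (k + 1) ⊔ Submodule.span ℂ {conjVec v} with hB
  have hcvB : conjVec v ∈ B := Submodule.mem_sup_right (Submodule.mem_span_singleton_self _)
  have hSB : prefixSpan L s (k + 1) ≤ conjSubmodule B := by
    conv_lhs => rw [hsuc]
    refine sup_le (hk.trans (conjSubmodule_mono (hmono.trans le_sup_left))) ?_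
    rwa [Submodule.span_singleton_le_iff_mem]
  have hBinv : B ≤ conjSubmodule B := by
    refine sup_le hSB ?_
    rw [Submodule.span_singleton_le_iff_mem, mem_conjSubmodule, conjVec_conjVec]
    exact Submodule.mem_sup_left hvS
  have hB' : conjSubmodule (prefixSpan L s (k + 1)) ≤ B := by
    have := conjSubmodule_mono hSB
    rwa [conjSubmodule_conjSubmodule] at this
  -- The prefix of length `k` is invariant, so a vector of the intersection with nonzero component
  -- along `v` would put `conjVec v` into the longer prefix.
  have hinter : prefixSpan L s (k + 1) ⊓ conjSubmodule (prefixSpan L s (k + 1)) ≤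
      prefixSpan L s k := by
    rintro u ⟨hu, hu'⟩
    rw [hsuc] at hu
    obtain ⟨w, hw, z, hz, rfl⟩ := Submodule.mem_sup.mp hu
    obtain ⟨α, rfl⟩ := Submodule.mem_span_singleton.mp hz
    have h1 : conjVec w + starRingEnd ℂ α • conjVec v ∈ prefixSpan L s (k + 1) := by
      rw [← conjVec_smul, ← conjVec_add]; exact hu'
    rw [Submodule.add_mem_iff_right _ (hmono (hk hw))] at h1
    by_cases hα : α = 0
    · simpa [hα] using hw
    · exact absurd ((Submodule.smul_mem_iff _ (by simpa using hα)).mp h1) hcv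
  have hcount := countIn_add_le (L := L) hinter (le_sup_left : _ ≤ B) hB'
  rw [countIn_conjSubmodule hF0 hL] at hcount
  have hBrank : Module.finrank ℂ B ≤ k + 2 :=
    (finrank_sup_span_singleton_le _ _).trans
      (Nat.add_le_add_right (finrank_prefixSpan_le L s hjn.le) 1)
  have hkrank : Module.finrank ℂ (prefixSpan L s k) ≤ k := finrank_prefixSpan_le L s hkn.le
  have hBbot : B ≠ ⊥ := by
    intro h
    have : v ∈ B := Submodule.mem_sup_left hvS
    rw [h, Submodule.mem_bot] at this
    exact hL0 _ this
  -- Since `2 * (k + 1) = k + (k + 2)`, either the prefix of dimension at most `k` or `B`, of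
  -- dimension at most `k + 2`, holds at least its share of forms.
  have hcount' : 2 * ((k + 1) * d) ≤ n * countIn L (prefixSpan L s k) + n * countIn L B := by
    nlinarith
  by_cases hBtop : B = ⊤
  · have hnk : n ≤ k + 2 := by
      rw [hBtop, finrank_top, Module.finrank_fin_fun] at hBrank
      exact hBrank
    rcases Nat.eq_zero_or_pos k with rfl | hk1
    · rw [prefixSpan_zero, bot_sup_eq] at hsuc
      refine absurd (isPosDefBinaryPower_of_countIn (L := L) (v := v) (by omega) hd hF0 hL
        ?_ ?_ ?_ ?_) hF
      · rw [eq_bot_iff]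
        refine le_trans ?_ (hinter.trans (prefixSpan_zero L s).le)
        rw [hsuc]
        refine inf_le_inf_left _ ?_
        rw [Submodule.span_singleton_le_iff_mem, mem_conjSubmodule, conjVec_conjVec]
        exact Submodule.mem_span_singleton_self _
      · rw [← hsuc]; exact hBtop
      · rw [← hsuc]
        calc d = (0 + 1) * d := by ring
          _ ≤ _ := hc
          _ ≤ _ := Nat.mul_le_mul_right _ hnk
      · rw [← countIn_conjSubmodule hF0 hL (Submodule.span ℂ {v})]
        congr 1
        apply le_antisymm
        · rw [Submodule.span_singleton_le_iff_mem, mem_conjSubmodule, conjVec_conjVec]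
          exact Submodule.mem_span_singleton_self _
        · intro u hu
          obtain ⟨α, hα⟩ := Submodule.mem_span_singleton.mp (mem_conjSubmodule.mp hu)
          refine Submodule.mem_span_singleton.mpr ⟨starRingEnd ℂ α, ?_⟩
          rw [← conjVec_smul, hα, conjVec_conjVec]
    -- Here `B` is the whole space and has at most its share, so the shorter prefix has at least its
    -- own.
    · refine volume_eq_top hL hk (hbot k hk1) (htop k hkn) ?_
      have h1 := countIn_le L B
      have h2 : n * countIn L B ≤ (k + 2) * d := Nat.mul_le_mul hnk h1
      refine (Nat.mul_le_mul_right d hkrank).trans ?_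
      nlinarith
  · by_cases hcB : (k + 2) * d ≤ n * countIn L B
    · exact volume_eq_top hL hBinv hBbot hBtop ((Nat.mul_le_mul_right d hBrank).trans hcB)
    · have hk2 : k * d < n * countIn L (prefixSpan L s k) := by nlinarith
      have hk1 : 1 ≤ k := by
        by_contra h0
        obtain rfl : k = 0 := by omega
        rw [prefixSpan_zero, countIn_bot hL0] at hk2
        omega
      exact volume_eq_top hL hk (hbot k hk1) (htop k hkn)
        ((Nat.mul_le_mul_right d hkrank).trans hk2.le)

theorem span_range_eq_top_of_volume_lt_top {F : MvPolynomial (Fin n) ℤ} {L : Fin d → Fin n → ℂ}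
    (hd : 1 ≤ d) (hF0 : F ≠ 0) (hL : IsFactorization F L) (hV : V F < ⊤) :
    Submodule.span ℂ (Set.range L) = ⊤ := by
  classical
  have hL0 := ne_zero_of_isFactorization hF0 hL
  have hmem : ∀ i, L i ∈ Submodule.span ℂ (Set.range L) := fun i =>
    Submodule.subset_span ⟨i, rfl⟩
  by_contra htop
  refine hV.ne (volume_eq_top hL (W := Submodule.span ℂ (Set.range L)) ?_ ?_ htop ?_)
  · rw [Submodule.span_le]
    rintro _ ⟨i, rfl⟩
    obtain ⟨i', c, hc⟩ := exists_eq_smul_conjVec hF0 hL i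
    have hc0 : c ≠ 0 := by
      rintro rfl
      exact hL0 i' (by simpa using hc)
    have := hmem i'
    rw [hc, Submodule.smul_mem_iff _ hc0] at this
    exact this
  · intro h
    have := hmem ⟨0, hd⟩
    rw [h, Submodule.mem_bot] at this
    exact hL0 _ this
  · have : countIn L (Submodule.span ℂ (Set.range L)) = d := by
      simp [countIn, hmem]
    rw [this]
    refine Nat.mul_le_mul_right d ?_
    simpa using Submodule.finrank_le (Submodule.span ℂ (Set.range L))

end DecomposableForm

/-! ### The equivalence -/

open DecomposableForm

theorem mainTheorem4 (n d : ℕ) (hn : 2 ≤ n) (hd : 1 ≤ d)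
    (F : MvPolynomial (Fin n) ℤ) (hF0 : F ≠ 0)
    (hF : ¬ DecomposableForm.IsPosDefBinaryPower F)
    (L : Fin d → Fin n → ℂ) (hL : DecomposableForm.IsFactorization F L) :
    DecomposableForm.V F < ⊤ ↔
      ∃ r : ℚ, DecomposableForm.a L = (r : WithBot ℚ) ∧ r < (d : ℚ) / (n : ℚ) := by
  classical
  have hL0 := ne_zero_of_isFactorization hF0 hL
  have hn0 : (0 : ℚ) < n := by exact_mod_cast (by omega : 0 < n)
  constructor
  · intro hV
    -- With constant sizes the greedy construction just shows that `J` is nonempty.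
    obtain ⟨s₀, hs₀, -⟩ := exists_greedy_mem_J hd (fun _ => 0) hL0
      (exists_eq_smul_conjVec hF0 hL) (span_range_eq_top_of_volume_lt_top hd hF0 hL hV)
      (fun _ _ _ _ => rfl)
    have hbot : a L ≠ ⊥ := by
      rw [Ne, a_eq_bot_iff hn]
      exact Finset.ne_empty_of_mem hs₀
    obtain ⟨r, hr⟩ := WithBot.ne_bot_iff_exists.mp hbot
    refine ⟨r, hr.symm, ?_⟩
    have hmem := Finset.mem_of_max hr.symm
    simp only [ratios, Finset.mem_image, Finset.mem_product, Finset.mem_Ico] at hmem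
    obtain ⟨⟨s, j⟩, ⟨hs, hj1, hjn⟩, rfl⟩ := hmem
    by_contra! hle
    have hj0 : (0 : ℚ) < j := by exact_mod_cast hj1
    rw [div_le_div_iff₀ hn0 hj0] at hle
    refine hV.ne (volume_eq_top_of_mem_J hd hF0 hF hL hs hj1 hjn ?_)
    have : d * j ≤ countIn L (prefixSpan L s j) * n := by exact_mod_cast hle
    linarith
  · rintro ⟨r, hr, hrd⟩
    have hne : (J L).Nonempty := by
      rw [Finset.nonempty_iff_ne_empty, Ne, ← a_eq_bot_iff hn, hr]
      exact WithBot.coe_ne_bot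
    have hbound : ∀ s ∈ J L, ∀ j, 1 ≤ j → j < n →
        (countIn L (prefixSpan L s j) : ℚ) ≤ r * j := by
      intro s hs j hj1 hjn
      have hmem : (countIn L (prefixSpan L s j) : ℚ) / (j : ℚ) ∈ ratios L :=
        Finset.mem_image.mpr ⟨(s, j), by simp [hs, hj1, hjn], rfl⟩
      have := Finset.le_max_of_eq hmem hr
      rwa [div_le_iff₀ (by exact_mod_cast hj1)] at this
    -- The ratio with `j = 1`, available as `n ≥ 2`, is at least `1`, since the first vector lies in
    -- its own span.
    have hr0 : 0 < r := by
      obtain ⟨s, hs⟩ := hne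
      have h1 := hbound s hs 1 le_rfl (by omega)
      have h2 : 0 < countIn L (prefixSpan L s 1) := by
        refine Finset.card_pos.mpr ⟨s ⟨0, by omega⟩, ?_⟩
        simpa using mem_prefixSpan L s (j := 1) ⟨0, by omega⟩ (by simp)
      have h3 : (1 : ℚ) ≤ countIn L (prefixSpan L s 1) := by exact_mod_cast h2
      simp only [Nat.cast_one, mul_one] at h1
      linarith
    rw [lt_div_iff₀ hn0] at hrd
    refine volume_lt_top (r := (r : ℝ)) (by omega) hd hF0 hL hne (by exact_mod_cast hr0)
      (by exact_mod_cast hrd) fun s hs j hj1 hjn => ?_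
    exact_mod_cast hbound s hs j hj1 hjn
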